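/- Let $\mathcal H$ be a separable infinite-dimensional Hilbert space and let $A_0, A_1$ be (nonzero) unital separable nuclear C$^*$-algebras. A completely positive contraction $\varphi: A_i\to B(\mathcal H)$ is called order zero if $\varphi(a)\varphi(b)=0$ for all positive $a,b\in A_i$ with $ab=0$. Let $\Lambda$ be the set of all pairs $(\varphi_0,\varphi_1)$ of order zero completely positive contractions $\varphi_i: A_i\to B(\mathcal H)$, $i=0,1$, such that $[\varphi_0(a_0),\varphi_1(a_1)]=0$ for all $a_0\in A_0$, $a_1\in A_1$, and $\varphi_0(1_{A_0})+\varphi_1(1_{A_1})=1_{B(\mathcal H)}$. For $i=0,1$ define $$\widetilde\varphi_i: A_i\to B\Big(\bigoplus_{\lambda\in\Lambda}\mathcal H\Big),\qquad \widetilde\varphi_i(a)=\bigoplus_{\lambda=(\varphi_{0,\lambda},\varphi_{1,\lambda})\in\Lambda}\varphi_{i,\lambda}(a),$$ and let $\widetilde I(A_0,A_1)$ be the C$^*$-subalgebra of $B(\bigoplus_{\lambda\in\Lambda}\mathcal H)$ generated by $\widetilde\varphi_0(A_0)\cup\widetilde\varphi_1(A_1)$ (the universal C$^*$-algebra of such pairs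 of maps). Let $$I(A_0,A_1)=\{f\in C([0,1],A_0\otimes A_1): f(0)\in A_0\otimes 1_{A_1},\ f(1)\in 1_{A_0}\otimes A_1\},$$ where $A_0\otimes A_1$ is the C$^*$-tensor product (unique since the algebras are nuclear). Then: (i) $\widetilde I(A_0,A_1)$ is $*$-isomorphic to $I(A_0,A_1)$. (ii) For every $k\in\mathbb N$, if both $A_0$ and $A_1$ contain the matrix algebra $M_k=M_k(\mathbb C)$ unitally (that is, there are injective unital $*$-homomorphisms $M_k\to A_0$ and $M_k\to A_1$), then $I(A_0,A_1)$ also contains $M_k$ unitally. -/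

import Mathlib

open scoped TensorProduct CStarAlgebra ENNReal

noncomputable section

/-! ### C⋆-seminorms and C⋆-norms -/

/-- A C⋆-seminorm on a complex ⋆-algebra `R`: a submultiplicative seminorm `p` with
`p (x⋆ x) = p (x) ^ 2`. -/
structure CStarSeminorm (R : Type*) [NonUnitalNonAssocRing R] [Star R] [Module ℂ R]
    extends Seminorm ℂ R where
  mul_le' : ∀ x y : R, toFun (x * y) ≤ toFun x * toFun y
  star_mul_self' : ∀ x : R, toFun (star x * x) = toFun x ^ 2

namespace CStarSeminorm

section Basic

variable {R : Type*} [NonUnitalNonAssocRing R] [Star R] [Module ℂ R]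

instance : FunLike (CStarSeminorm R) R ℝ where
  coe p := p.toFun
  coe_injective p q h := by
    cases p; cases q; congr; exact DFunLike.coe_injective h

/-- A C⋆-seminorm is a C⋆-norm if it vanishes only at `0`. -/
def IsNorm (p : CStarSeminorm R) : Prop := ∀ x : R, p x = 0 → x = 0

variable (p : CStarSeminorm R)

lemma nonneg (x : R) : 0 ≤ p x := apply_nonneg p.toSeminorm x
lemma add_le (x y : R) : p (x + y) ≤ p x + p y := map_add_le_add p.toSeminorm x y
lemma map_neg_eq (x : R) : p (-x) = p x := map_neg_eq_map p.toSeminorm x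
lemma map_smul_eq (c : ℂ) (x : R) : p (c • x) = ‖c‖ * p x := p.smul' c x
lemma mul_le (x y : R) : p (x * y) ≤ p x * p y := p.mul_le' x y
lemma star_mul_self (x : R) : p (star x * x) = p x ^ 2 := p.star_mul_self' x

end Basic

/-! ### The C⋆-algebra obtained from a C⋆-seminorm -/

section Completion

variable {R : Type*} [Ring R] [StarRing R] [Algebra ℂ R]

lemma le_map_star (p : CStarSeminorm R) (x : R) : p x ≤ p (star x) := by
  rcases (p.nonneg x).eq_or_lt with h | h
  · rw [← h]; exact p.nonneg _
  · have h1 := p.mul_le (star x) x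
    rw [p.star_mul_self, sq] at h1
    exact le_of_mul_le_mul_right h1 h

lemma map_star_eq (p : CStarSeminorm R) (x : R) : p (star x) = p x :=
  le_antisymm (by simpa using p.le_map_star (star x)) (p.le_map_star x)

/-- The ⋆-algebra `R`, seen as a seminormed algebra with the seminorm `p`. -/
@[nolint unusedArguments]
def Pre (_p : CStarSeminorm R) : Type _ := R

variable (p : CStarSeminorm R)

instance : Ring p.Pre := inferInstanceAs (Ring R)
instance : StarRing p.Pre := inferInstanceAs (StarRing R)
instance : Algebra ℂ p.Pre := inferInstanceAs (Algebra ℂ R)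
instance [StarModule ℂ R] : StarModule ℂ p.Pre := inferInstanceAs (StarModule ℂ R)

/-- The identity map from `R` to `R` with the seminorm `p`. -/
def toPre : R ≃⋆ₐ[ℂ] p.Pre := StarAlgEquiv.refl ℂ R

instance : SeminormedRing p.Pre where
  __ := (inferInstance : Ring p.Pre)
  norm := p
  dist x y := p (-x + y)
  dist_self x := by
    change p.toSeminorm (-x + x) = 0
    rw [neg_add_cancel]; exact map_zero _
  dist_comm x y := by
    change p (-x + y) = p (-y + x)
    rw [← p.map_neg_eq (-x + y)]; congr 1; abel
  dist_triangle x y z := by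
    change p (-x + z) ≤ p (-x + y) + p (-y + z)
    refine le_trans (le_of_eq ?_) (p.add_le _ _)
    congr 1; abel
  dist_eq x y := rfl
  norm_mul_le := p.mul_le

lemma norm_toPre (x : R) : ‖p.toPre x‖ = p x := rfl

instance : NormedAlgebra ℂ p.Pre where
  norm_smul_le c x := (p.map_smul_eq c x).le

instance : NormedStarGroup p.Pre where
  norm_star_le x := (p.map_star_eq x).le

/-- The Hausdorff completion of `R` with respect to the C⋆-seminorm `p`. -/
abbrev Completion : Type _ := UniformSpace.Completion p.Pre

lemma uniformContinuous_star : UniformContinuous (star : p.Pre → p.Pre) :=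
  (starNormedAddGroupHom (E := p.Pre)).uniformContinuous

/-- The involution is extended by continuity. -/
instance : Star p.Completion where
  star := UniformSpace.Completion.map star

lemma star_coe (x : p.Pre) : star (x : p.Completion) = ((star x : p.Pre) : p.Completion) :=
  UniformSpace.Completion.map_coe p.uniformContinuous_star x

lemma continuous_star_completion : Continuous (star : p.Completion → p.Completion) :=
  UniformSpace.Completion.continuous_map

instance [StarModule ℂ R] : CStarAlgebra p.Completion where
  star_involutive x := by
    have := p.continuous_star_completion
    induction x using UniformSpace.Completion.induction_on with
    | hp => exact isClosed_eq (this.comp this) continuous_id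
    | ih a => rw [star_coe, star_coe, star_star]
  star_mul x y := by
    have := p.continuous_star_completion
    induction x, y using UniformSpace.Completion.induction_on₂ with
    | hp => exact isClosed_eq (by fun_prop) (by fun_prop)
    | ih a b =>
      rw [← UniformSpace.Completion.coe_mul, star_coe, star_coe, star_coe, star_mul,
        UniformSpace.Completion.coe_mul]
  star_add x y := by
    have := p.continuous_star_completion
    induction x, y using UniformSpace.Completion.induction_on₂ with
    | hp => exact isClosed_eq (by fun_prop) (by fun_prop)
    | ih a b =>
      rw [← UniformSpace.Completion.coe_add, star_coe, star_coe, star_coe, star_add,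
        UniformSpace.Completion.coe_add]
  norm_smul_le := norm_smul_le
  norm_mul_self_le x := by
    have := p.continuous_star_completion
    induction x using UniformSpace.Completion.induction_on with
    | hp => exact isClosed_le (by fun_prop) (by fun_prop)
    | ih a =>
      rw [star_coe, ← UniformSpace.Completion.coe_mul, UniformSpace.Completion.norm_coe,
        UniformSpace.Completion.norm_coe, ← sq]
      exact (p.star_mul_self a).ge
  star_smul c x := by
    have := p.continuous_star_completion
    induction x using UniformSpace.Completion.induction_on with
    | hp => exact isClosed_eq (this.comp (continuous_const_smul c))
                    ((continuous_const_smul (star c)).comp this)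
    | ih a =>
      rw [← UniformSpace.Completion.coe_smul, star_coe, star_coe, star_smul,
        UniformSpace.Completion.coe_smul]

/-- The canonical map from `R` to its completion, as a unital ⋆-homomorphism. -/
def toCompletion [StarModule ℂ R] : R →⋆ₐ[ℂ] p.Completion where
  toFun x := (p.toPre x : p.Completion)
  map_one' := rfl
  map_mul' _ _ := UniformSpace.Completion.coe_mul _ _
  map_zero' := rfl
  map_add' _ _ := UniformSpace.Completion.coe_add _ _
  commutes' _ := rfl
  map_star' _ := (p.star_coe _).symm

lemma norm_toCompletion [StarModule ℂ R] (x : R) : ‖p.toCompletion x‖ = p x :=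
  UniformSpace.Completion.norm_coe _

end Completion

end CStarSeminorm

/-! ### The C⋆-tensor product -/

section Tensor

variable (A B : Type*) [CStarAlgebra A] [CStarAlgebra B]

/-- `a ↦ a ⊗ 1` on the algebraic tensor product. -/
def algTensorLeft : A →⋆ₐ[ℂ] A ⊗[ℂ] B where
  __ := (Algebra.TensorProduct.includeLeft : A →ₐ[ℂ] A ⊗[ℂ] B)
  map_star' a := by simp

/-- `b ↦ 1 ⊗ b` on the algebraic tensor product. -/
def algTensorRight : B →⋆ₐ[ℂ] A ⊗[ℂ] B where
  __ := (Algebra.TensorProduct.includeRight : B →ₐ[ℂ] A ⊗[ℂ] B)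
  map_star' b := by simp

variable {A B}

lemma CStarSeminorm.tmul_le (p : CStarSeminorm (A ⊗[ℂ] B)) (a : A) (b : B) :
    p (a ⊗ₜ b) ≤ ‖a‖ * ‖b‖ := by
  have h : a ⊗ₜ[ℂ] b = algTensorLeft A B a * algTensorRight A B b := by
    change a ⊗ₜ[ℂ] b = (a ⊗ₜ[ℂ] (1 : B)) * ((1 : A) ⊗ₜ[ℂ] b)
    simp
  have ha : p (algTensorLeft A B a) ≤ ‖a‖ := by
    rw [← p.norm_toCompletion]
    exact NonUnitalStarAlgHom.norm_apply_le (p.toCompletion.comp (algTensorLeft A B)) a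
  have hb : p (algTensorRight A B b) ≤ ‖b‖ := by
    rw [← p.norm_toCompletion]
    exact NonUnitalStarAlgHom.norm_apply_le (p.toCompletion.comp (algTensorRight A B)) b
  rw [h]
  exact (p.mul_le _ _).trans (mul_le_mul ha hb (p.nonneg _) (norm_nonneg _))

lemma CStarSeminorm.bddAbove_range (x : A ⊗[ℂ] B) :
    BddAbove (Set.range fun p : CStarSeminorm (A ⊗[ℂ] B) ↦ p x) := by
  induction x using TensorProduct.induction_on with
  | zero => exact ⟨0, by rintro _ ⟨p, rfl⟩; exact (map_zero p.toSeminorm).le⟩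
  | tmul a b => exact ⟨‖a‖ * ‖b‖, by rintro _ ⟨p, rfl⟩; exact p.tmul_le a b⟩
  | add x y hx hy =>
    obtain ⟨C, hC⟩ := hx
    obtain ⟨D, hD⟩ := hy
    exact ⟨C + D, by
      rintro _ ⟨p, rfl⟩
      exact (p.add_le x y).trans (add_le_add (hC ⟨p, rfl⟩) (hD ⟨p, rfl⟩))⟩

instance : Nonempty (CStarSeminorm (A ⊗[ℂ] B)) :=
  ⟨{ (0 : Seminorm ℂ (A ⊗[ℂ] B)) with
      mul_le' := fun _ _ ↦ (mul_zero (0 : ℝ)).ge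
      star_mul_self' := fun _ ↦ (zero_pow two_ne_zero).symm }⟩

variable (A B) in
/-- The maximal C⋆-norm on `A ⊗ B`: the supremum of all C⋆-seminorms. -/
def maxTensorNorm : CStarSeminorm (A ⊗[ℂ] B) where
  toFun x := ⨆ p : CStarSeminorm (A ⊗[ℂ] B), p x
  map_zero' := by
    have : ∀ p : CStarSeminorm (A ⊗[ℂ] B), p 0 = 0 := fun p ↦ map_zero p.toSeminorm
    simp [this]
  add_le' x y := ciSup_le fun p ↦ (p.add_le x y).trans
    (add_le_add (le_ciSup (CStarSeminorm.bddAbove_range x) p)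
      (le_ciSup (CStarSeminorm.bddAbove_range y) p))
  neg' x := by simp [CStarSeminorm.map_neg_eq]
  smul' c x := by
    simp only [CStarSeminorm.map_smul_eq]
    exact (Real.mul_iSup_of_nonneg (norm_nonneg c) _).symm
  mul_le' x y := ciSup_le fun p ↦ (p.mul_le x y).trans
    (mul_le_mul (le_ciSup (CStarSeminorm.bddAbove_range x) p)
      (le_ciSup (CStarSeminorm.bddAbove_range y) p) (p.nonneg y)
      (Real.iSup_nonneg fun q ↦ q.nonneg x))
  star_mul_self' x := by
    simp only [CStarSeminorm.star_mul_self]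
    refine le_antisymm (ciSup_le fun p ↦ ?_) ?_
    · exact pow_le_pow_left₀ (p.nonneg x) (le_ciSup (CStarSeminorm.bddAbove_range x) p) 2
    · have hb : BddAbove (Set.range fun p : CStarSeminorm (A ⊗[ℂ] B) ↦ p x ^ 2) := by
        simpa only [CStarSeminorm.star_mul_self] using
          CStarSeminorm.bddAbove_range (star x * x)
      have hs : 0 ≤ ⨆ p : CStarSeminorm (A ⊗[ℂ] B), p x ^ 2 :=
        Real.iSup_nonneg fun p ↦ sq_nonneg _
      refine (Real.le_sqrt (Real.iSup_nonneg fun q ↦ q.nonneg x) hs).1 (ciSup_le fun p ↦ ?_)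
      exact Real.le_sqrt_of_sq_le (le_ciSup hb p)

variable (A B) in
/-- The C⋆-tensor product of `A` and `B`: the completion of the algebraic tensor product in its
maximal C⋆-norm. When `A` or `B` is nuclear, this is the only C⋆-norm on the algebraic tensor
product (so it is also the spatial norm), and the completion is the unambiguous C⋆-tensor product. -/
abbrev CStarTensor : Type _ := (maxTensorNorm A B).Completion

variable (A B) in
/-- The ⋆-homomorphism `a ↦ a ⊗ 1`. -/
def tensorLeft : A →⋆ₐ[ℂ] CStarTensor A B :=
  (maxTensorNorm A B).toCompletion.comp (algTensorLeft A B)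

variable (A B) in
/-- The ⋆-homomorphism `b ↦ 1 ⊗ b`. -/
def tensorRight : B →⋆ₐ[ℂ] CStarTensor A B :=
  (maxTensorNorm A B).toCompletion.comp (algTensorRight A B)

end Tensor

universe u

/-- A C⋆-algebra `A` is nuclear if for every C⋆-algebra `B` there is only one C⋆-norm on the
algebraic tensor product of `A` and `B`. -/
def IsNuclear (A : Type u) [NonUnitalCStarAlgebra A] : Prop :=
  ∀ (B : Type u) [NonUnitalCStarAlgebra B] (p q : CStarSeminorm (A ⊗[ℂ] B)),
    p.IsNorm → q.IsNorm → p = q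

/-! ### The algebra `I(A₀, A₁)` -/

section Interval

variable (A₀ A₁ : Type*) [CStarAlgebra A₀] [CStarAlgebra A₁]

/-- The C⋆-algebra of all continuous `f : [0, 1] → A₀ ⊗ A₁` with `f 0 ∈ A₀ ⊗ 1` and
`f 1 ∈ 1 ⊗ A₁`. -/
def intervalAlgebra : StarSubalgebra ℂ C(unitInterval, CStarTensor A₀ A₁) where
  carrier := {f | f 0 ∈ (tensorLeft A₀ A₁).range ∧ f 1 ∈ (tensorRight A₀ A₁).range}
  mul_mem' hf hg := ⟨mul_mem hf.1 hg.1, mul_mem hf.2 hg.2⟩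
  add_mem' hf hg := ⟨add_mem hf.1 hg.1, add_mem hf.2 hg.2⟩
  algebraMap_mem' c := ⟨algebraMap_mem (tensorLeft A₀ A₁).range c,
    algebraMap_mem (tensorRight A₀ A₁).range c⟩
  star_mem' hf := ⟨star_mem hf.1, star_mem hf.2⟩

end Interval

/-! ### The universal algebra of commuting order zero maps -/

section Universal

/-- A completely positive map is an order zero contraction if it is contractive and preserves
orthogonality of positive elements. -/
structure IsOrderZeroContraction {A B : Type*} [CStarAlgebra A] [PartialOrder A]
    [StarOrderedRing A] [CStarAlgebra B] [PartialOrder B] [StarOrderedRing B]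
    (φ : A →CP B) : Prop where
  norm_le : ∀ a, ‖φ a‖ ≤ ‖a‖
  orthogonal : ∀ a b, 0 ≤ a → 0 ≤ b → a * b = 0 → φ a * φ b = 0

variable (A₀ A₁ : Type*) [CStarAlgebra A₀] [PartialOrder A₀] [StarOrderedRing A₀]
  [CStarAlgebra A₁] [PartialOrder A₁] [StarOrderedRing A₁]
  (H : Type*) [NormedAddCommGroup H] [InnerProductSpace ℂ H] [CompleteSpace H]

/-- The index set `Λ`: all pairs of order zero completely positive contractions
`φ₀ : A₀ → B(H)`, `φ₁ : A₁ → B(H)` with commuting ranges and `φ₀(1) + φ₁(1) = 1`. -/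
structure OrderZeroPair where
  map₀ : A₀ →CP (H →L[ℂ] H)
  map₁ : A₁ →CP (H →L[ℂ] H)
  orderZero₀ : IsOrderZeroContraction map₀
  orderZero₁ : IsOrderZeroContraction map₁
  commute : ∀ a₀ a₁, Commute (map₀ a₀) (map₁ a₁)
  map_one_add : map₀ 1 + map₁ 1 = 1

/-- The Hilbert space `⨁_{Λ} H`. -/
abbrev OrderZeroSpace : Type _ := lp (fun _ : OrderZeroPair A₀ A₁ H ↦ H) 2

variable {A₀ A₁}

/-- The operator `⨁_{λ ∈ Λ} φ_{0,λ}(a)` on `⨁_{Λ} H`. -/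
def univMap₀ (a : A₀) : OrderZeroSpace A₀ A₁ H →L[ℂ] OrderZeroSpace A₀ A₁ H :=
  lp.mapCLM 2 (fun l : OrderZeroPair A₀ A₁ H ↦ l.map₀ a) (norm_nonneg a)
    fun l ↦ l.orderZero₀.norm_le a

/-- The operator `⨁_{λ ∈ Λ} φ_{1,λ}(a)` on `⨁_{Λ} H`. -/
def univMap₁ (a : A₁) : OrderZeroSpace A₀ A₁ H →L[ℂ] OrderZeroSpace A₀ A₁ H :=
  lp.mapCLM 2 (fun l : OrderZeroPair A₀ A₁ H ↦ l.map₁ a) (norm_nonneg a)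
    fun l ↦ l.orderZero₁.norm_le a

variable (A₀ A₁)

/-- The C⋆-subalgebra of `B(⨁_{Λ} H)` generated by the ranges of the two direct sum maps. -/
def universalAlgebra :
    NonUnitalStarSubalgebra ℂ (OrderZeroSpace A₀ A₁ H →L[ℂ] OrderZeroSpace A₀ A₁ H) :=
  (NonUnitalStarAlgebra.adjoin ℂ
    (Set.range (univMap₀ (A₀ := A₀) (A₁ := A₁) H) ∪
      Set.range (univMap₁ (A₀ := A₀) (A₁ := A₁) H))).topologicalClosure

end Universal

/-- `A` contains the matrix algebra `M_k` unitally. -/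
def ContainsMatrixUnitally (k : ℕ) (A : Type*) [Ring A] [StarRing A] [Algebra ℂ A] : Prop :=
  ∃ f : Matrix (Fin k) (Fin k) ℂ →⋆ₐ[ℂ] A, Function.Injective f

end

/-! An order zero map is a homomorphism multiplied by a commuting weight. With `h = φ 1`, the
identities needed are: `h` commutes with the range, `φ a * φ a = h * φ (a * a)` for self-adjoint
`a`, and `h * (h * φ (a * b)) = h * (φ a * φ b)` (`IsWeightedHom`). They are derived without
biduals. For self-adjoint `b`, orthogonality forces the differences of the elements `φ ((b - i)⁺)`
to interact as if `φ` were `h` times a homomorphism. Take `b = n a + const`. The commutator of `φ b`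
with `h` is bounded by 2 but scales like `n`; the defect in the square identity is bounded linearly
in `n` but scales like `n²`. Both vanish, and two-positivity with polarization passes from squares
to products.

For (i) it suffices that each ⋆-polynomial in the generators has the same norm in both algebras
(`norm_fst_eq_norm_snd`). A point `t` and a representation `ρ` of the tensor product on `H` give a
member of `Λ`, namely `(1 - t) ρ(a ⊗ 1)` and `t ρ(1 ⊗ b)`, so the direct sum dominates the sup norm.
Conversely, `univMap₁ H 1` is central in its own centralizer, which contains all generators, so some
GNS representation norms the polynomial and makes this element a scalar `t`. There the two maps are
`1 - t` and `t` times commuting homomorphisms, hence come from a representation of the tensor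
product evaluated at `t`; at the endpoints one map vanishes and an amplification supplies the
missing homomorphism. That the generators exhaust the interval algebra is Bernstein approximation
(`closure_adjoin_intervalGenerators`).

For (ii), two commuting copies of `M_k` are exchanged by the flip `∑ L(eᵢⱼ) R(eⱼᵢ)`, a self-adjoint
unitary joined to `1` by a path of unitaries. Conjugating one copy along this path gives the
embedding (`exists_hom_rotating`). -/

noncomputable section

/-! ### Ramp sequences -/

section Ramp

variable {R : Type*} [Ring R]

/-- A sequence `u` behaving like `i ↦ φ ((b - i)⁺)` for an orthogonality preserving map `φ`
with `φ 1 = h`. -/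
structure IsRamp (h : R) (u : ℕ → R) : Prop where
  mul_left : ∀ i j, i ≤ j → u j * (u i - u 0 + i • h) = 0
  mul_right : ∀ i j, i ≤ j → (u i - u 0 + i • h) * u j = 0

namespace IsRamp

variable {h : R} {u : ℕ → R} (hu : IsRamp h u)
include hu

lemma mul_step {i j : ℕ} (hij : i < j) : u j * (u i - u (i + 1)) = u j * h := by
  have h1 := hu.mul_left i j hij.le
  have h2 := hu.mul_left (i + 1) j hij
  rw [succ_nsmul] at h2
  generalize i • h = k at *
  calc u j * (u i - u (i + 1)) = u j * (u i - u 0 + k) - u j * (u (i + 1) - u 0 + (k + h))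
        + u j * h := by noncomm_ring
    _ = _ := by rw [h1, h2]; simp

lemma step_mul {i j : ℕ} (hij : i < j) : (u i - u (i + 1)) * u j = h * u j := by
  have h1 := hu.mul_right i j hij.le
  have h2 := hu.mul_right (i + 1) j hij
  rw [succ_nsmul] at h2
  generalize i • h = k at *
  calc (u i - u (i + 1)) * u j = (u i - u 0 + k) * u j - (u (i + 1) - u 0 + (k + h)) * u j
        + h * u j := by noncomm_ring
    _ = _ := by rw [h1, h2]; simp

/-- Let `r`, `s`, `q` be consecutive differences. Then `s r = s h`, `r s = h s`, and `q` annihilates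
`r - s` on both sides, so `[s, h] = [s, r] = [s - q, r - s]`. Second differences are wanted because
they come from positive tent functions whose sum is a contraction. -/
lemma commutator_step (i : ℕ) :
    (u (i + 1) - u (i + 2)) * h - h * (u (i + 1) - u (i + 2)) =
      ((u (i + 1) - u (i + 2)) - (u (i + 2) - u (i + 3))) *
        ((u i - u (i + 1)) - (u (i + 1) - u (i + 2))) -
      ((u i - u (i + 1)) - (u (i + 1) - u (i + 2))) *
        ((u (i + 1) - u (i + 2)) - (u (i + 2) - u (i + 3))) := by
  have a1 := hu.mul_step (i := i) (j := i + 1) (by lia)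
  have a2 := hu.mul_step (i := i) (j := i + 2) (by lia)
  have a3 := hu.mul_step (i := i) (j := i + 3) (by lia)
  have a4 := hu.mul_step (i := i + 1) (j := i + 2) (by lia)
  have a5 := hu.mul_step (i := i + 1) (j := i + 3) (by lia)
  have b1 := hu.step_mul (i := i) (j := i + 1) (by lia)
  have b2 := hu.step_mul (i := i) (j := i + 2) (by lia)
  have b3 := hu.step_mul (i := i) (j := i + 3) (by lia)
  have b4 := hu.step_mul (i := i + 1) (j := i + 2) (by lia)
  have b5 := hu.step_mul (i := i + 1) (j := i + 3) (by lia)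
  simp only [show i + 1 + 1 = i + 2 from rfl] at *
  generalize hr : u i - u (i + 1) = r at *
  generalize hs : u (i + 1) - u (i + 2) = s at *
  have e1 : s * r = s * h := by rw [← hs, sub_mul, sub_mul, a1, a2]
  have e1' : r * s = h * s := by rw [← hs, mul_sub, mul_sub, b1, b2]
  have e2 : (u (i + 2) - u (i + 3)) * (r - s) = 0 := by
    rw [sub_mul, mul_sub, mul_sub, a2, a3, a4, a5]; simp
  have e2' : (r - s) * (u (i + 2) - u (i + 3)) = 0 := by
    rw [mul_sub, sub_mul, sub_mul, b2, b3, b4, b5]; simp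
  rw [sub_mul, mul_sub (r - s), e2, e2', mul_sub, sub_mul, e1, e1']
  abel

/-- Expand the square of `u (i + 1) + (u i - u (i + 1))`: in the cross terms the difference acts on
`u (i + 1)` as `h`. -/
lemma sq_step (i : ℕ) :
    u i * u i = u (i + 1) * u (i + 1) + (u (i + 1) * h + h * u (i + 1)) +
      (u i - u (i + 1)) * (u i - u (i + 1)) := by
  rw [← hu.mul_step (lt_add_one i), ← hu.step_mul (lt_add_one i)]
  noncomm_ring

lemma sq_eq_sum (n : ℕ) :
    u 0 * u 0 = u n * u n + ∑ i ∈ Finset.range n, ((u (i + 1) * h + h * u (i + 1)) +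
      (u i - u (i + 1)) * (u i - u (i + 1))) := by
  induction n with
  | zero => simp
  | succ n ih => rw [ih, Finset.sum_range_succ, hu.sq_step n]; abel

lemma commutator_eq_sum {n : ℕ} (hn : u (n + 1) = 0) (h0 : u 0 - u 1 = h) :
    u 0 * h - h * u 0 = ∑ i ∈ Finset.range n,
      (((u (i + 1) - u (i + 2)) - (u (i + 2) - u (i + 3))) *
        ((u i - u (i + 1)) - (u (i + 1) - u (i + 2))) -
      ((u i - u (i + 1)) - (u (i + 1) - u (i + 2))) *
        ((u (i + 1) - u (i + 2)) - (u (i + 2) - u (i + 3)))) := by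
  have key : ∀ m, u 1 * h - h * u 1 = (u (m + 1) * h - h * u (m + 1)) +
      ∑ i ∈ Finset.range m, ((u (i + 1) - u (i + 2)) * h - h * (u (i + 1) - u (i + 2))) := by
    intro m
    induction m with
    | zero => simp
    | succ m ih => rw [ih, Finset.sum_range_succ]; noncomm_ring
  rw [← Finset.sum_congr rfl fun i _ ↦ hu.commutator_step i]
  have := key n
  rw [hn] at this
  rw [show u 0 = u 1 + h by rw [← h0]; abel]
  simp only [zero_mul, mul_zero, sub_zero, zero_add] at this
  rw [← this]
  noncomm_ring

end IsRamp

end Ramp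

/-! ### Orthogonal ramps by functional calculus -/

section CFCRamp

variable {A : Type*} [CStarAlgebra A]

/-- The element `(b - t)⁺`. -/
def rampElement (b : A) (t : ℝ) : A := cfc (fun x : ℝ ↦ max (x - t) 0) b

variable {b : A}

lemma rampElement_nonneg [PartialOrder A] [StarOrderedRing A] (t : ℝ) : 0 ≤ rampElement b t :=
  cfc_nonneg fun _ _ ↦ le_max_right _ _

lemma sub_cfc_eq (hb : IsSelfAdjoint b) (f : ℝ → ℝ) (hf : Continuous f) (s : ℝ) :
    cfc (fun x : ℝ ↦ f x - (x - s)) b = cfc f b - b + s • 1 := by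
  have hc : ∀ {g : ℝ → ℝ}, Continuous g → ContinuousOn g (spectrum ℝ b) := fun h ↦ h.continuousOn
  rw [show (fun x : ℝ ↦ f x - (x - s)) = fun x ↦ (f x - x) + s by funext x; ring,
    cfc_add_const s (fun x ↦ f x - x) b (hc (by fun_prop)),
    cfc_sub f (fun x ↦ x) b (hc hf) (hc (by fun_prop)), cfc_id' ℝ b,
    Algebra.algebraMap_eq_smul_one]

lemma rampElement_sub_nonneg [PartialOrder A] [StarOrderedRing A] (hb : IsSelfAdjoint b) (s : ℝ) :
    0 ≤ rampElement b s - b + s • 1 := by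
  rw [rampElement, ← sub_cfc_eq hb _ (by fun_prop)]
  exact cfc_nonneg fun x _ ↦ by have := le_max_left (x - s) 0; linarith

/-- The second factor is the negative part `(b - s)⁻`, which lives where `x ≤ s ≤ t`; there `(x -
t)⁺` vanishes. -/
lemma rampElement_mul (hb : IsSelfAdjoint b) {s t : ℝ} (hst : s ≤ t) :
    rampElement b t * (rampElement b s - b + s • 1) = 0 := by
  have hc : ∀ {g : ℝ → ℝ}, Continuous g → ContinuousOn g (spectrum ℝ b) := fun h ↦ h.continuousOn
  rw [rampElement, rampElement, ← sub_cfc_eq hb _ (by fun_prop),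
    ← cfc_mul _ _ b (hc (by fun_prop)) (hc (by fun_prop))]
  convert cfc_const_zero ℝ b using 3 with x
  rcases le_total x t with h | h
  · rw [max_eq_right (by linarith), zero_mul]
  · rw [max_eq_left (b := 0) (a := x - s) (by linarith), sub_self, mul_zero]

lemma rampElement_eq_sub (hb : IsSelfAdjoint b) {t : ℝ} (ht : ∀ x ∈ spectrum ℝ b, t ≤ x) :
    rampElement b t = b - t • 1 := by
  have hc : ∀ {g : ℝ → ℝ}, Continuous g → ContinuousOn g (spectrum ℝ b) := fun h ↦ h.continuousOn
  rw [rampElement, cfc_congr (g := fun x ↦ x - t)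
    (fun x hx ↦ max_eq_left (sub_nonneg.2 (ht x hx))),
    cfc_sub (fun x ↦ x) (fun _ ↦ t) b (hc (by fun_prop)) (hc (by fun_prop)), cfc_id' ℝ b,
    cfc_const t b, Algebra.algebraMap_eq_smul_one]

lemma rampElement_eq_zero {t : ℝ} (ht : ∀ x ∈ spectrum ℝ b, x ≤ t) : rampElement b t = 0 := by
  rw [rampElement, cfc_congr (g := fun _ ↦ 0)
    (fun x hx ↦ max_eq_right (sub_nonpos.2 (ht x hx))), cfc_const_zero]

lemma norm_rampElement_sub_le (s : ℝ) :
    ‖rampElement b s - rampElement b (s + 1)‖ ≤ 1 := by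
  have hc : ∀ {g : ℝ → ℝ}, Continuous g → ContinuousOn g (spectrum ℝ b) := fun h ↦ h.continuousOn
  rw [rampElement, rampElement, ← cfc_sub _ _ b (hc (by fun_prop)) (hc (by fun_prop))]
  refine norm_cfc_le zero_le_one fun x _ ↦ ?_
  rw [Real.norm_eq_abs, abs_le]
  constructor <;>
  · rcases max_cases (x - s) 0 with h1 | h1 <;> rcases max_cases (x - (s + 1)) 0 with h2 | h2 <;>
      linarith

/-- The second difference of `x ↦ (x - s)⁺` is the tent of height 1 supported on `[s, s + 2]`. -/
lemma rampElement_second_diff_nonneg [PartialOrder A] [StarOrderedRing A] (s : ℝ) :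
    0 ≤ (rampElement b s - rampElement b (s + 1)) -
      (rampElement b (s + 1) - rampElement b (s + 2)) := by
  have hc : ∀ {g : ℝ → ℝ}, Continuous g → ContinuousOn g (spectrum ℝ b) := fun h ↦ h.continuousOn
  rw [rampElement, rampElement, rampElement, ← cfc_sub _ _ b (hc (by fun_prop)) (hc (by fun_prop)),
    ← cfc_sub _ _ b (hc (by fun_prop)) (hc (by fun_prop)),
    ← cfc_sub _ _ b (hc (by fun_prop)) (hc (by fun_prop))]
  refine cfc_nonneg fun x _ ↦ ?_
  rcases max_cases (x - s) 0 with h1 | h1 <;> rcases max_cases (x - (s + 1)) 0 with h2 | h2 <;>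
    rcases max_cases (x - (s + 2)) 0 with h3 | h3 <;> linarith

lemma norm_rampElement_second_diff_le (s : ℝ) :
    ‖(rampElement b s - rampElement b (s + 1)) -
      (rampElement b (s + 1) - rampElement b (s + 2))‖ ≤ 1 := by
  have hc : ∀ {g : ℝ → ℝ}, Continuous g → ContinuousOn g (spectrum ℝ b) := fun h ↦ h.continuousOn
  rw [rampElement, rampElement, rampElement, ← cfc_sub _ _ b (hc (by fun_prop)) (hc (by fun_prop)),
    ← cfc_sub _ _ b (hc (by fun_prop)) (hc (by fun_prop)),
    ← cfc_sub _ _ b (hc (by fun_prop)) (hc (by fun_prop))]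
  refine norm_cfc_le zero_le_one fun x _ ↦ ?_
  rw [Real.norm_eq_abs, abs_le]
  constructor <;>
  · rcases max_cases (x - s) 0 with h1 | h1 <;> rcases max_cases (x - (s + 1)) 0 with h2 | h2 <;>
      rcases max_cases (x - (s + 2)) 0 with h3 | h3 <;> linarith

end CFCRamp

/-! ### Order zero maps -/

section CompletelyPositive

variable {A B : Type*} [CStarAlgebra A] [PartialOrder A] [StarOrderedRing A]
  [CStarAlgebra B] [PartialOrder B] [StarOrderedRing B]

lemma CStarMatrix.apply_self_nonneg {n : Type*} [Fintype n] [DecidableEq n] {P : CStarMatrix n n B}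
    (hP : 0 ≤ P) (i : n) : 0 ≤ P i i := by
  rw [StarOrderedRing.nonneg_iff] at hP
  induction hP using AddSubmonoid.closure_induction with
  | mem x hx =>
    obtain ⟨s, rfl⟩ := hx
    simp only [CStarMatrix.mul_apply]
    exact Finset.sum_nonneg fun k _ ↦ star_mul_self_nonneg (s k i)
  | zero => exact le_rfl
  | add x y _ _ hx hy => exact add_nonneg hx hy

variable (φ : A →CP B)

lemma CompletelyPositiveMap.apply_nonneg {a : A} (ha : 0 ≤ a) : 0 ≤ φ a := map_nonneg φ ha

lemma CompletelyPositiveMap.apply_star (a : A) : φ (star a) = star (φ a) := map_star φ a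

/-- The two-positivity inequality. -/
lemma CompletelyPositiveMap.two_positive (a : A) (y z : B) :
    0 ≤ star y * φ 1 * y + star y * φ a * z + star z * star (φ a) * y +
      star z * φ (star a * a) * z := by
  -- Here `star M * M` has rows `(1, a)` and `(star a, star a * a)`; conjugating its image by the
  -- column `(y, z)` gives the expression as a diagonal entry.
  let M : CStarMatrix (Fin 2) (Fin 2) A := CStarMatrix.ofMatrix !![1, a; 0, 0]
  have hM : 0 ≤ star M * M := star_mul_self_nonneg M
  have hP := φ.map_cstarMatrix_nonneg' 2 _ hM
  let N : CStarMatrix (Fin 2) (Fin 2) B := CStarMatrix.ofMatrix !![y, 0; z, 0]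
  have := CStarMatrix.apply_self_nonneg (star_left_conjugate_nonneg hP N) 0
  have hφ : ∀ x, φ.toLinearMap x = φ x := fun _ ↦ rfl
  simp [CStarMatrix.mul_apply, Fin.sum_univ_two, N, M, CStarMatrix.star_eq_conjTranspose,
    CStarMatrix.conjTranspose_apply, CStarMatrix.map_apply, hφ, φ.apply_star] at this
  convert this using 1
  noncomm_ring

end CompletelyPositive

/-! ### Order zero maps on ramps: bounding the commutator with `φ 1`. -/

section OrderZero

variable {A : Type*} [CStarAlgebra A] [PartialOrder A] [StarOrderedRing A]
  {H : Type*} [NormedAddCommGroup H] [InnerProductSpace ℂ H] [CompleteSpace H]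

open scoped InnerProductSpace

/-- A positive contraction `e` satisfies `‖e ξ‖² ≤ ⟪e ξ, ξ⟫`. -/
lemma ContinuousLinearMap.norm_apply_sq_le_re_inner {e : H →L[ℂ] H} (he : 0 ≤ e) (he1 : ‖e‖ ≤ 1)
    (ξ : H) : ‖e ξ‖ ^ 2 ≤ (⟪e ξ, ξ⟫_ℂ).re := by
  have hsa : IsSelfAdjoint e := .of_nonneg he
  have h1 : e ^ 2 ≤ e := by
    have hle : e ≤ 1 := (CStarAlgebra.norm_le_one_iff_of_nonneg e he).1 he1
    simpa using CStarAlgebra.pow_antitone he hle (show 1 ≤ 2 by lia)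
  have h2 := (ContinuousLinearMap.le_def _ _).1 h1
  have h3 := h2.re_inner_nonneg_left ξ
  have h4 : ⟪(e ^ 2) ξ, ξ⟫_ℂ = ⟪e ξ, e ξ⟫_ℂ := by
    rw [sq, mul_apply_eq_comp]
    exact (ContinuousLinearMap.isSelfAdjoint_iff_isSymmetric.1 hsa) _ _
  rw [sub_apply, inner_sub_left, h4, inner_self_eq_norm_sq_to_K] at h3
  simp only [map_sub] at h3
  have h5 : RCLike.re (((‖e ξ‖ : ℝ) : ℂ) ^ 2) = ‖e ξ‖ ^ 2 := by norm_cast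
  erw [h5] at h3
  simpa using h3

/-- If `e₀, …, eₙ` are positive contractions whose sum is a contraction, then
`∑ e_{i+1} e_i` is a contraction. -/
lemma ContinuousLinearMap.norm_sum_succ_mul_le {e : ℕ → H →L[ℂ] H} {n : ℕ}
    (he : ∀ i, 0 ≤ e i) (he1 : ∀ i, ‖e i‖ ≤ 1)
    (hs : ‖∑ i ∈ Finset.range (n + 1), e i‖ ≤ 1) :
    ‖∑ i ∈ Finset.range n, e (i + 1) * e i‖ ≤ 1 := by
  -- Since `e² ≤ e`, these squares are controlled by the sum of the `e i`. Cauchy–Schwarz over `i`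
  -- then pairs the family with its shift.
  have key : ∀ ξ, ∑ i ∈ Finset.range (n + 1), ‖e i ξ‖ ^ 2 ≤ ‖ξ‖ ^ 2 := by
    intro ξ
    calc ∑ i ∈ Finset.range (n + 1), ‖e i ξ‖ ^ 2
        ≤ ∑ i ∈ Finset.range (n + 1), (⟪e i ξ, ξ⟫_ℂ).re :=
          Finset.sum_le_sum fun i _ ↦ norm_apply_sq_le_re_inner (he i) (he1 i) ξ
      _ = (⟪(∑ i ∈ Finset.range (n + 1), e i) ξ, ξ⟫_ℂ).re := by
          rw [sum_apply, sum_inner, Complex.re_sum]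
      _ ≤ ‖(∑ i ∈ Finset.range (n + 1), e i) ξ‖ * ‖ξ‖ := re_inner_le_norm (𝕜 := ℂ) _ _
      _ ≤ (1 * ‖ξ‖) * ‖ξ‖ := by gcongr; exact ContinuousLinearMap.le_of_opNorm_le _ hs ξ
      _ = ‖ξ‖ ^ 2 := by ring
  have key1 : ∀ ξ, ∑ i ∈ Finset.range n, ‖e i ξ‖ ^ 2 ≤ ‖ξ‖ ^ 2 := fun ξ ↦
    (Finset.sum_le_sum_of_subset_of_nonneg (Finset.range_mono n.le_succ)
      fun _ _ _ ↦ sq_nonneg _).trans (key ξ)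
  have key2 : ∀ ξ, ∑ i ∈ Finset.range n, ‖e (i + 1) ξ‖ ^ 2 ≤ ‖ξ‖ ^ 2 := fun ξ ↦ by
    have := key ξ
    rw [Finset.sum_range_succ'] at this
    linarith [sq_nonneg ‖e 0 ξ‖]
  refine ContinuousLinearMap.opNorm_le_of_re_inner_le zero_le_one fun ξ η hξ hη ↦ ?_
  rw [sum_apply, sum_inner]
  have hsa : ∀ i, ⟪(e (i + 1) * e i) ξ, η⟫_ℂ = ⟪e i ξ, e (i + 1) η⟫_ℂ := fun i ↦
    (ContinuousLinearMap.isSelfAdjoint_iff_isSymmetric.1 (.of_nonneg (he (i + 1)))) _ _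
  simp only [hsa]
  calc RCLike.re (∑ i ∈ Finset.range n, ⟪e i ξ, e (i + 1) η⟫_ℂ)
      ≤ ‖∑ i ∈ Finset.range n, ⟪e i ξ, e (i + 1) η⟫_ℂ‖ := RCLike.re_le_norm _
    _ ≤ ∑ i ∈ Finset.range n, ‖e i ξ‖ * ‖e (i + 1) η‖ :=
        (norm_sum_le _ _).trans (Finset.sum_le_sum fun i _ ↦ norm_inner_le_norm _ _)
    _ ≤ √(∑ i ∈ Finset.range n, ‖e i ξ‖ ^ 2) * √(∑ i ∈ Finset.range n, ‖e (i + 1) η‖ ^ 2) :=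
        Real.sum_mul_le_sqrt_mul_sqrt _ _ _
    _ ≤ √(‖ξ‖ ^ 2) * √(‖η‖ ^ 2) := by gcongr; exacts [key1 ξ, key2 η]
    _ = 1 := by rw [hξ, hη]; simp

lemma isRamp_rampElement {b : A} (hb : IsSelfAdjoint b) (hb1 : ∀ x ∈ spectrum ℝ b, 0 ≤ x) :
    IsRamp (1 : A) fun i : ℕ ↦ rampElement b i := by
  have h0 : rampElement b ((0 : ℕ) : ℝ) = b := by rw [rampElement_eq_sub hb (by simpa using hb1)]; simp
  have key : ∀ i j : ℕ, i ≤ j → rampElement b j * (rampElement b i - rampElement b ((0 : ℕ) : ℝ) +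
      i • 1) = 0 := fun i j hij ↦ by
    rw [h0, ← Nat.cast_smul_eq_nsmul ℝ]
    exact rampElement_mul hb (by exact_mod_cast hij)
  refine ⟨key, fun i j hij ↦ ?_⟩
  have hs : ∀ t, star (rampElement b t) = rampElement b t := fun t ↦
    (IsSelfAdjoint.of_nonneg (rampElement_nonneg t)).star_eq
  simpa [hs] using congrArg star (key i j hij)

namespace IsOrderZeroContraction

variable {φ : A →CP (H →L[ℂ] H)} (hφ : IsOrderZeroContraction φ)
include hφ

lemma isRamp {b : A} (hb : IsSelfAdjoint b) (hb1 : ∀ x ∈ spectrum ℝ b, 0 ≤ x) :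
    IsRamp (φ 1) fun i : ℕ ↦ φ (rampElement b i) := by
  have h0 : rampElement b ((0 : ℕ) : ℝ) = b := by rw [rampElement_eq_sub hb (by simpa using hb1)]; simp
  have h1 : ∀ i : ℕ, φ (rampElement b i) - φ (rampElement b ((0 : ℕ) : ℝ)) + i • φ 1 =
      φ (rampElement b i - b + (i : ℝ) • 1) := fun i ↦ by
    rw [h0, Nat.cast_smul_eq_nsmul, map_add, map_sub, map_nsmul]
  have key : ∀ i j : ℕ, i ≤ j → φ (rampElement b j) * (φ (rampElement b i) -
      φ (rampElement b ((0 : ℕ) : ℝ)) + i • φ 1) = 0 := fun i j hij ↦ by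
    rw [h1]
    exact hφ.orthogonal _ _ (rampElement_nonneg _) (rampElement_sub_nonneg hb _)
      (rampElement_mul hb (by exact_mod_cast hij))
  refine ⟨key, fun i j hij ↦ ?_⟩
  have hs : ∀ t, star (φ (rampElement b t)) = φ (rampElement b t) := fun t ↦
    (IsSelfAdjoint.of_nonneg (φ.apply_nonneg (rampElement_nonneg t))).star_eq
  have hone : star (φ 1) = φ 1 := by rw [← φ.apply_star, star_one]
  simpa [hs, hone, -nsmul_eq_mul] using congrArg star (key i j hij)

/-- The bound is independent of `n`. The spectral bound `1 ≤ x` makes the first difference of the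
ramp equal to `φ 1`, and `x ≤ n + 1` makes the ramp vanish from `n + 1` on. The commutator is then
`X - star X` with `X = ∑ e (i + 1) * e i` for the images `e i` of the tents, and `‖X‖ ≤ 1`. -/
lemma norm_commutator_le {b : A} (hb : IsSelfAdjoint b) {n : ℕ}
    (hb1 : ∀ x ∈ spectrum ℝ b, 1 ≤ x ∧ x ≤ n + 1) :
    ‖φ b * φ 1 - φ 1 * φ b‖ ≤ 2 := by
  have hu := hφ.isRamp hb fun x hx ↦ zero_le_one.trans (hb1 x hx).1
  have hz : ∀ m : ℕ, n + 1 ≤ m → rampElement b m = 0 := fun m hm ↦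
    rampElement_eq_zero fun x hx ↦ (hb1 x hx).2.trans (by exact_mod_cast hm)
  have h0 : rampElement b ((0 : ℕ) : ℝ) = b := by
    rw [rampElement_eq_sub hb fun x hx ↦ by simpa using zero_le_one.trans (hb1 x hx).1]; simp
  have h1 : rampElement b ((1 : ℕ) : ℝ) = b - 1 := by
    rw [rampElement_eq_sub hb fun x hx ↦ by simpa using (hb1 x hx).1]; simp
  have hsum := hu.commutator_eq_sum (n := n) (by simp only [hz _ le_rfl, map_zero])
    (by simp only [h0, h1, map_sub, sub_sub_cancel])
  let e : ℕ → H →L[ℂ] H := fun i ↦ φ ((rampElement b i - rampElement b (i + 1)) -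
    (rampElement b (i + 1) - rampElement b (i + 2)))
  have he : ∀ i, 0 ≤ e i := fun i ↦ φ.apply_nonneg (rampElement_second_diff_nonneg _)
  have he1 : ∀ i, ‖e i‖ ≤ 1 := fun i ↦ (hφ.norm_le _).trans (norm_rampElement_second_diff_le _)
  have hes : ‖∑ i ∈ Finset.range (n + 1), e i‖ ≤ 1 := by
    -- Second differences telescope to a difference of first differences, the last of which vanishes
    -- at `m = n + 1`.
    have : ∀ m, ∑ i ∈ Finset.range m, e i =
        φ ((rampElement b 0 - rampElement b 1) - (rampElement b m - rampElement b (m + 1))) := by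
      intro m
      induction m with
      | zero => simp
      | succ m ih =>
        rw [Finset.sum_range_succ, ih, ← map_add]
        congr 1
        push_cast
        rw [show (m : ℝ) + 1 + 1 = m + 2 by ring]
        abel
    rw [this]
    have e1 := hz (n + 1) le_rfl
    have e2 := hz (n + 2) (by lia)
    push_cast at e1 e2 ⊢
    rw [e1, show (n : ℝ) + 1 + 1 = n + 2 by ring, e2, sub_zero, sub_zero]
    simpa using (hφ.norm_le _).trans (norm_rampElement_sub_le (b := b) 0)
  have hle := ContinuousLinearMap.norm_sum_succ_mul_le he he1 hes
  have hstar : ∑ i ∈ Finset.range n, e i * e (i + 1) =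
      star (∑ i ∈ Finset.range n, e (i + 1) * e i) := by
    simp [star_sum, (IsSelfAdjoint.of_nonneg (he _)).star_eq]
  have heq : φ b * φ 1 - φ 1 * φ b = ∑ i ∈ Finset.range n, e (i + 1) * e i -
      ∑ i ∈ Finset.range n, e i * e (i + 1) := by
    rw [← Finset.sum_sub_distrib]
    rw [h0] at hsum
    rw [hsum]
    refine Finset.sum_congr rfl fun i _ ↦ ?_
    simp only [e, map_sub]
    push_cast
    rw [show (i : ℝ) + 1 + 1 = i + 2 by ring, show (i : ℝ) + 1 + 2 = i + 3 by ring]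
  rw [heq, hstar]
  refine (norm_sub_le _ _).trans ?_
  rw [norm_star]
  linarith

end IsOrderZeroContraction

end OrderZero

/-! ### The scaling argument and the identities for order zero maps. -/

section OrderZero

variable {A : Type*} [CStarAlgebra A]

lemma norm_nsmul_real {E : Type*} [NormedAddCommGroup E] [NormedSpace ℝ E] (n : ℕ) (x : E) :
    ‖n • x‖ = n • ‖x‖ := by
  rw [← Nat.cast_smul_eq_nsmul ℝ, norm_smul, Real.norm_natCast, nsmul_eq_mul]

lemma norm_eq_zero_of_forall_nat_mul_le {E : Type*} [NormedAddCommGroup E] {x : E} {C : ℝ}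
    (h : ∀ n : ℕ, 1 ≤ n → n * ‖x‖ ≤ C) : x = 0 := by
  by_contra hx
  obtain ⟨n, hn⟩ := exists_nat_gt (C / ‖x‖)
  rw [div_lt_iff₀ (norm_pos_iff.2 hx)] at hn
  have := h (n + 1) (by lia)
  push_cast at this
  nlinarith [norm_nonneg x]

lemma IsSelfAdjoint.nsmul_add_nsmul_one {a : A} (ha : IsSelfAdjoint a) (n m : ℕ) :
    IsSelfAdjoint (n • a + m • (1 : A)) := by
  simp [isSelfAdjoint_iff, ha.star_eq, -nsmul_eq_mul]

variable [PartialOrder A] [StarOrderedRing A]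

/-- From `-K ≤ a ≤ K`: the shift by `n * K + 1` pushes the spectrum of `n • a` to the right of 1, as
the ramp bounds require, and its length stays linear in `n`. -/
lemma IsSelfAdjoint.spectrum_nsmul_add_nsmul_one {a : A} (ha : IsSelfAdjoint a) {K : ℕ}
    (hK : ‖a‖ ≤ K) (n : ℕ) {x : ℝ} (hx : x ∈ spectrum ℝ (n • a + (n * K + 1) • (1 : A))) :
    1 ≤ x ∧ x ≤ (2 * n * K : ℕ) + 1 := by
  have hb := ha.nsmul_add_nsmul_one n (n * K + 1)
  have h1 : (algebraMap ℝ A (-K)) ≤ a := by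
    refine le_trans ?_ ha.neg_algebraMap_norm_le_self
    rw [← map_neg]
    exact algebraMap_mono A (neg_le_neg hK)
  have h2 : a ≤ algebraMap ℝ A K := ha.le_algebraMap_norm_self.trans (algebraMap_mono A hK)
  have e1 : algebraMap ℝ A 1 = n • algebraMap ℝ A (-K) + (n * K + 1) • (1 : A) := by
    simp
  have e2 : algebraMap ℝ A ((2 * n * K : ℕ) + 1) =
      n • algebraMap ℝ A K + (n * K + 1) • (1 : A) := by
    simp [two_mul, add_mul]; abel
  constructor
  · refine (algebraMap_le_iff_le_spectrum (a := n • a + (n * K + 1) • (1 : A)) hb).1 ?_ x hx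
    rw [e1]
    gcongr
  · refine (le_algebraMap_iff_spectrum_le (a := n • a + (n * K + 1) • (1 : A)) hb).1 ?_ x hx
    rw [e2]
    gcongr

lemma sub_mul_add_add_mul_sub_I_smul {R : Type*} [Ring R] [Algebra ℂ R] (x y : R) :
    (x - Complex.I • y) * (x + Complex.I • y) + (x + Complex.I • y) * (x - Complex.I • y) =
      2 • (x * x) + 2 • (y * y) := by
  simp only [add_mul, mul_add, sub_mul, mul_sub, smul_mul_assoc, mul_smul_comm, smul_smul,
    smul_add, smul_sub, Complex.I_mul_I, neg_smul, one_smul]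
  abel

variable {H : Type*} [NormedAddCommGroup H] [InnerProductSpace ℂ H] [CompleteSpace H]

namespace IsOrderZeroContraction

variable {φ : A →CP (H →L[ℂ] H)} (hφ : IsOrderZeroContraction φ)
include hφ

/-- Replacing `a` by `n • a` plus a multiple of `1` multiplies the commutator by `n`, yet it stays
bounded by 2. -/
lemma commute_one_of_isSelfAdjoint {a : A} (ha : IsSelfAdjoint a) : Commute (φ a) (φ 1) := by
  obtain ⟨K, hK⟩ := exists_nat_ge ‖a‖
  refine sub_eq_zero.1 (norm_eq_zero_of_forall_nat_mul_le (C := 2) fun n hn ↦ ?_)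
  have := hφ.norm_commutator_le (ha.nsmul_add_nsmul_one n (n * K + 1)) fun x hx ↦
    ha.spectrum_nsmul_add_nsmul_one hK n hx
  refine le_trans (le_of_eq ?_) this
  rw [← nsmul_eq_mul, ← norm_nsmul_real]
  congr 1
  simp only [map_add, map_nsmul]
  simp only [add_mul, mul_add, smul_mul_assoc, mul_smul_comm, smul_sub]
  abel

lemma commute_one (a : A) : Commute (φ a) (φ 1) := by
  rw [← realPart_add_I_smul_imaginaryPart a, map_add, map_smul]
  exact (hφ.commute_one_of_isSelfAdjoint (realPart a).2).add_left
    ((hφ.commute_one_of_isSelfAdjoint (imaginaryPart a).2).smul_left _)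

/-- The square is expanded along two ramps, one in `B(H)` with weight `φ 1` and one in `A` with
weight `1`. After applying `φ 1 * φ ·` to the second, the cross terms cancel, and each of the `n +
1` steps leaves a defect of norm at most 2. -/
lemma norm_sq_sub_le {b : A} (hb : IsSelfAdjoint b) {n : ℕ}
    (hb1 : ∀ x ∈ spectrum ℝ b, 1 ≤ x ∧ x ≤ n + 1) :
    ‖φ b * φ b - φ 1 * φ (b * b)‖ ≤ 2 * (n + 1) := by
  have hpos : ∀ x ∈ spectrum ℝ b, 0 ≤ x := fun x hx ↦ zero_le_one.trans (hb1 x hx).1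
  have hz : rampElement b ((n + 1 : ℕ) : ℝ) = 0 :=
    rampElement_eq_zero fun x hx ↦ (hb1 x hx).2.trans (by simp)
  have h0 : rampElement b ((0 : ℕ) : ℝ) = b := by
    rw [rampElement_eq_sub hb (by simpa using hpos)]; simp
  have h1 := (hφ.isRamp hb hpos).sq_eq_sum (n + 1)
  have h2 := (isRamp_rampElement hb hpos).sq_eq_sum (n + 1)
  have hr : ∀ i : ℕ, ‖rampElement b (i : ℝ) - rampElement b ((i + 1 : ℕ) : ℝ)‖ ≤ 1 := fun i ↦ by
    push_cast; exact norm_rampElement_sub_le _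
  simp only [hz, h0, map_zero, mul_zero, zero_add, mul_one, one_mul] at h1 h2
  have hone : ‖φ 1‖ ≤ 1 := by
    refine (hφ.norm_le _).trans ?_
    rcases subsingleton_or_nontrivial A with _ | _
    · simp [Subsingleton.elim (1 : A) 0]
    · simp
  rw [h1, h2, map_sum, Finset.mul_sum, ← Finset.sum_sub_distrib]
  calc _ ≤ ∑ i ∈ Finset.range (n + 1), (2 : ℝ) := by
        refine norm_sum_le_of_le _ fun i _ ↦ ?_
        have e : ∀ p r : A, (φ p * φ 1 + φ 1 * φ p + φ r * φ r) - φ 1 * φ (p + p + r * r) =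
            φ r * φ r - φ 1 * φ (r * r) := fun p r ↦ by
          rw [(hφ.commute_one p).eq, map_add, map_add]; noncomm_ring
        rw [← map_sub, e]
        generalize hrr : rampElement b (i : ℝ) - rampElement b ((i + 1 : ℕ) : ℝ) = r
        have hr1 : ‖r‖ ≤ 1 := hrr ▸ hr i
        have hφr : ‖φ r‖ ≤ 1 := (hφ.norm_le r).trans hr1
        have hφr2 : ‖φ (r * r)‖ ≤ 1 := (hφ.norm_le _).trans
          ((norm_mul_le _ _).trans (mul_le_one₀ hr1 (norm_nonneg _) hr1))
        calc _ ≤ ‖φ r * φ r‖ + ‖φ 1 * φ (r * r)‖ := norm_sub_le _ _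
          _ ≤ 1 + 1 := add_le_add
              ((norm_mul_le _ _).trans (mul_le_one₀ hφr (norm_nonneg _) hφr))
              ((norm_mul_le _ _).trans (mul_le_one₀ hone (norm_nonneg _) hφr2))
          _ = 2 := by norm_num
    _ = 2 * (n + 1) := by simp; ring

/-- Because `φ 1` commutes with `φ a`, the defect ignores shifts by multiples of `1`; it scales by
`n * n` while its bound is linear in `n`. -/
lemma mul_self_of_isSelfAdjoint {a : A} (ha : IsSelfAdjoint a) :
    φ a * φ a = φ 1 * φ (a * a) := by
  obtain ⟨K, hK⟩ := exists_nat_ge ‖a‖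
  -- The constant comes from `2 * (2 * n * K + 1) ≤ n * (2 * (2 * K + 1))` for `n ≥ 1`.
  refine sub_eq_zero.1 (norm_eq_zero_of_forall_nat_mul_le (C := 2 * (2 * K + 1)) fun n hn ↦ ?_)
  have := hφ.norm_sq_sub_le (ha.nsmul_add_nsmul_one n (n * K + 1)) fun x hx ↦
    ha.spectrum_nsmul_add_nsmul_one hK n hx
  have hn' : (1 : ℝ) ≤ n := by exact_mod_cast hn
  have e : φ (n • a + (n * K + 1) • 1) * φ (n • a + (n * K + 1) • 1) -
      φ 1 * φ ((n • a + (n * K + 1) • 1) * (n • a + (n * K + 1) • 1)) =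
      (n * n) • (φ a * φ a - φ 1 * φ (a * a)) := by
    generalize n * K + 1 = m
    simp only [add_mul, mul_add, smul_mul_assoc, mul_smul_comm, map_add, map_nsmul, smul_sub,
      smul_add, mul_one, one_mul, (hφ.commute_one a).eq, smul_smul]
    abel
  rw [e, norm_nsmul_real, nsmul_eq_mul] at this
  push_cast at this
  have h3 : (n : ℝ) * (n * ‖φ a * φ a - φ 1 * φ (a * a)‖) ≤ n * (2 * (2 * K + 1)) := by
    nlinarith
  exact le_of_mul_le_mul_left h3 (by linarith)

/-- The structure theorem of order zero maps, in the form of an identity. -/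
lemma one_mul_star_mul_self (a : A) :
    φ 1 * (φ 1 * φ (star a * a)) = φ 1 * (star (φ a) * φ a) := by
  have hone : star (φ 1) = φ 1 := by rw [← φ.apply_star, star_one]
  -- A Schwarz inequality, from two-positivity with `y = -φ x` and `z = φ 1`.
  have hpos : ∀ x : A, 0 ≤ φ 1 * (φ 1 * φ (star x * x)) - φ 1 * (star (φ x) * φ x) := fun x ↦ by
    have := φ.two_positive x (-φ x) (φ 1)
    have c1 := (hφ.commute_one x).eq
    have c2 := (hφ.commute_one (star x)).eq
    have c3 := (hφ.commute_one (star x * x)).eq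
    rw [φ.apply_star] at c2
    convert this using 1
    rw [star_neg, hone]
    simp only [neg_mul, mul_neg, mul_assoc, c1, c3]
    rw [← mul_assoc (star (φ x)), c2]
    noncomm_ring
  obtain ⟨b, c, hb, hc, rfl⟩ : ∃ b c : A, IsSelfAdjoint b ∧ IsSelfAdjoint c ∧
      a = b + Complex.I • c :=
    ⟨_, _, (realPart a).2, (imaginaryPart a).2, (realPart_add_I_smul_imaginaryPart a).symm⟩
  set a := b + Complex.I • c with ha
  -- As `star a * a + a * star a = 2 b² + 2 c²`, the identity for self-adjoint squares makes the
  -- defects of `a` and `star a` cancel. Multiplied by `φ 1` both are nonnegative, hence both are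
  -- zero.
  have hsum : (φ 1 * φ (star a * a) - star (φ a) * φ a) +
      (φ 1 * φ (star (star a) * star a) - star (φ (star a)) * φ (star a)) = 0 := by
    have eb := hφ.mul_self_of_isSelfAdjoint hb
    have ec := hφ.mul_self_of_isSelfAdjoint hc
    have hstar : star a = b - Complex.I • c := by
      simp [ha, hb.star_eq, hc.star_eq, sub_eq_add_neg]
    have h1 : star a * a + star (star a) * star a = 2 • (b * b) + 2 • (c * c) := by
      rw [star_star, hstar, ha]
      exact sub_mul_add_add_mul_sub_I_smul b c
    have h2 : star (φ a) * φ a + star (φ (star a)) * φ (star a) =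
        2 • (φ b * φ b) + 2 • (φ c * φ c) := by
      rw [← φ.apply_star, ← φ.apply_star, star_star, hstar, ha]
      simp only [map_add, map_sub, map_smul]
      exact sub_mul_add_add_mul_sub_I_smul (φ b) (φ c)
    calc _ = φ 1 * φ (star a * a + star (star a) * star a) -
          (star (φ a) * φ a + star (φ (star a)) * φ (star a)) := by
          rw [map_add φ (star a * a)]; noncomm_ring
      _ = 0 := by
          rw [h1, h2, map_add, map_nsmul, map_nsmul, eb, ec]; noncomm_ring
  have h0 := hpos a
  have h1 := hpos (star a)
  have h2 : φ 1 * (φ 1 * φ (star a * a)) - φ 1 * (star (φ a) * φ a) =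
      -(φ 1 * (φ 1 * φ (star (star a) * star a)) - φ 1 * (star (φ (star a)) * φ (star a))) := by
    rw [eq_neg_iff_add_eq_zero, ← mul_sub, ← mul_sub, ← mul_add, hsum, mul_zero]
  refine sub_eq_zero.1 (le_antisymm ?_ h0)
  rw [h2]
  exact neg_nonpos.2 h1

end IsOrderZeroContraction

end OrderZero

/-! ### Weighted homomorphisms -/

/-- The algebraic identities satisfied by order zero maps `Φ = h π` with `h = Φ 1`. -/
structure IsWeightedHom {A D : Type*} [Ring A] [StarRing A] [Algebra ℂ A] [Ring D] [StarRing D]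
    [Algebra ℂ D] (Φ : A → D) : Prop where
  map_add : ∀ a b, Φ (a + b) = Φ a + Φ b
  map_smul : ∀ (c : ℂ) a, Φ (c • a) = c • Φ a
  map_star : ∀ a, Φ (star a) = star (Φ a)
  commute_one : ∀ a, Commute (Φ a) (Φ 1)
  mul_self : ∀ a, IsSelfAdjoint a → Φ a * Φ a = Φ 1 * Φ (a * a)
  one_mul : ∀ a b, Φ 1 * (Φ 1 * Φ (a * b)) = Φ 1 * (Φ a * Φ b)

namespace IsWeightedHom

variable {A D E : Type*} [Ring A] [StarRing A] [Algebra ℂ A] [Ring D] [StarRing D] [Algebra ℂ D]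
  [Ring E] [StarRing E] [Algebra ℂ E] {Φ : A → D}

lemma comp (hΦ : IsWeightedHom Φ) (σ : D →⋆ₐ[ℂ] E) : IsWeightedHom fun a ↦ σ (Φ a) where
  map_add a b := by rw [hΦ.map_add, _root_.map_add]
  map_smul c a := by rw [hΦ.map_smul, _root_.map_smul]
  map_star a := by rw [hΦ.map_star, StarHomClass.map_star]
  commute_one a := (hΦ.commute_one a).map σ
  mul_self a ha := by rw [← map_mul, ← map_mul, hΦ.mul_self a ha]
  one_mul a b := by rw [← map_mul, ← map_mul, ← map_mul, ← map_mul, hΦ.one_mul]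

lemma of_comp_injective {σ : D →⋆ₐ[ℂ] E} (hσ : Function.Injective σ)
    (hΦ : IsWeightedHom fun a ↦ σ (Φ a)) : IsWeightedHom Φ where
  map_add a b := hσ (by simpa using hΦ.map_add a b)
  map_smul c a := hσ (by simpa using hΦ.map_smul c a)
  map_star a := hσ (by simpa [StarHomClass.map_star] using hΦ.map_star a)
  commute_one a := hσ (by simpa using (hΦ.commute_one a).eq)
  mul_self a ha := hσ (by simpa using hΦ.mul_self a ha)
  one_mul a b := hσ (by simpa using hΦ.one_mul a b)

/-- A weighted homomorphism with invertible scalar weight is a multiple of a homomorphism. -/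
lemma exists_eq_smul [StarModule ℂ D] (hΦ : IsWeightedHom Φ) {s : ℝ} (hs : s ≠ 0)
    (h1 : Φ 1 = (s : ℂ) • 1) : ∃ ρ : A →⋆ₐ[ℂ] D, ∀ a, Φ a = (s : ℂ) • ρ a := by
  have hs' : (s : ℂ) ≠ 0 := by exact_mod_cast hs
  have h0 : Φ 0 = 0 := by simpa using hΦ.map_smul 0 0
  have hmul : ∀ a b, (s : ℂ) • Φ (a * b) = Φ a * Φ b := fun a b ↦ by
    have := hΦ.one_mul a b
    rw [h1] at this
    simp only [smul_mul_assoc, _root_.one_mul] at this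
    exact smul_right_injective _ hs' this
  refine ⟨{ toFun := fun a ↦ (s : ℂ)⁻¹ • Φ a
            map_one' := by rw [h1, inv_smul_smul₀ hs']
            map_mul' := fun a b ↦ ?_
            map_zero' := by rw [h0, smul_zero]
            map_add' := fun a b ↦ by rw [hΦ.map_add, smul_add]
            commutes' := fun c ↦ ?_
            map_star' := fun a ↦ ?_ }, fun a ↦ (smul_inv_smul₀ hs' _).symm⟩
  · rw [smul_mul_smul_comm, ← hmul, smul_smul, mul_assoc, inv_mul_cancel₀ hs', mul_one]
  · rw [Algebra.algebraMap_eq_smul_one, Algebra.algebraMap_eq_smul_one, hΦ.map_smul, h1,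
      smul_comm, inv_smul_smul₀ hs']
  · rw [hΦ.map_star, star_smul]
    simp

lemma eq_zero {A D : Type*} [Ring A] [StarRing A] [Algebra ℂ A] [StarModule ℂ A] [CStarAlgebra D]
    {Φ : A → D} (hΦ : IsWeightedHom Φ) (h1 : Φ 1 = 0) (a : A) : Φ a = 0 := by
  have hsa : ∀ a, IsSelfAdjoint a → Φ a = 0 := fun a ha ↦ by
    have := hΦ.mul_self a ha
    rw [h1, zero_mul] at this
    nth_rewrite 1 [← ha.star_eq] at this
    rwa [hΦ.map_star, CStarRing.star_mul_self_eq_zero_iff] at this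
  rw [← realPart_add_I_smul_imaginaryPart a, hΦ.map_add, hΦ.map_smul, hsa _ (realPart a).2,
    hsa _ (imaginaryPart a).2, smul_zero, add_zero]

end IsWeightedHom

/-! ### Polarization: order zero contractions are weighted homomorphisms. -/

section OrderZero

variable {A : Type*} [CStarAlgebra A] [PartialOrder A] [StarOrderedRing A]
  {H : Type*} [NormedAddCommGroup H] [InnerProductSpace ℂ H] [CompleteSpace H]

/-- Polarization: `x + y` yields the symmetric sum of the mixed terms, and substituting `I • b` and
multiplying by `-I` yields their difference. -/
lemma IsOrderZeroContraction.one_mul_star_mul {φ : A →CP (H →L[ℂ] H)}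
    (hφ : IsOrderZeroContraction φ) (a b : A) :
    φ 1 * (φ 1 * φ (star a * b)) = φ 1 * (star (φ a) * φ b) := by
  have key : ∀ x y : A, φ 1 * (φ 1 * φ (star x * y)) + φ 1 * (φ 1 * φ (star y * x)) =
      φ 1 * (star (φ x) * φ y) + φ 1 * (star (φ y) * φ x) := fun x y ↦ by
    have h := hφ.one_mul_star_mul_self (x + y)
    have hx := hφ.one_mul_star_mul_self x
    have hy := hφ.one_mul_star_mul_self y
    simp only [star_add, add_mul, mul_add, map_add, hx, hy] at h
    have h' := congrArg (fun t ↦ t - φ 1 * (star (φ x) * φ x) - φ 1 * (star (φ y) * φ y)) h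
    convert h' using 1 <;> abel
  have h1 := key a b
  have h2 := key a (Complex.I • b)
  simp only [star_smul, mul_smul_comm, smul_mul_assoc, map_smul, Complex.star_def, Complex.conj_I,
    neg_smul, neg_mul, mul_neg, map_neg] at h2
  have h3 := congrArg (fun t ↦ (-Complex.I) • t) h2
  simp only [smul_add, smul_neg, smul_smul, Complex.I_mul_I, neg_neg, one_smul,
    neg_mul] at h3
  have h4 : (2 : ℂ) • (φ 1 * (φ 1 * φ (star a * b))) = (2 : ℂ) • (φ 1 * (star (φ a) * φ b)) := by
    rw [two_smul, two_smul]
    have := congrArg₂ (· + ·) h1 h3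
    convert this using 1 <;> abel
  exact smul_right_injective _ two_ne_zero h4

lemma IsOrderZeroContraction.isWeightedHom {φ : A →CP (H →L[ℂ] H)}
    (hφ : IsOrderZeroContraction φ) : IsWeightedHom φ where
  map_add := map_add φ
  map_smul := map_smul φ
  map_star := φ.apply_star
  commute_one := hφ.commute_one
  mul_self _ := hφ.mul_self_of_isSelfAdjoint
  one_mul a b := by
    have := hφ.one_mul_star_mul (star a) b
    rwa [φ.apply_star, star_star, star_star] at this

end OrderZero

/-! ### The direct sum maps inherit the identities coordinatewise. -/

section Universal

variable {A₀ A₁ : Type*} [CStarAlgebra A₀] [PartialOrder A₀] [StarOrderedRing A₀]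
  [CStarAlgebra A₁] [PartialOrder A₁] [StarOrderedRing A₁]
  {H : Type*} [NormedAddCommGroup H] [InnerProductSpace ℂ H] [CompleteSpace H]

@[simp] lemma univMap₀_apply (a : A₀) (x : OrderZeroSpace A₀ A₁ H) (l : OrderZeroPair A₀ A₁ H) :
    univMap₀ H a x l = l.map₀ a (x l) := rfl

@[simp] lemma univMap₁_apply (a : A₁) (x : OrderZeroSpace A₀ A₁ H) (l : OrderZeroPair A₀ A₁ H) :
    univMap₁ H a x l = l.map₁ a (x l) := rfl

lemma lp.clm_ext {ι : Type*} {E : ι → Type*} [∀ i, NormedAddCommGroup (E i)]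
    [∀ i, NormedSpace ℂ (E i)] {V : Type*} [NormedAddCommGroup V] [NormedSpace ℂ V]
    {f g : V →L[ℂ] lp E 2} (h : ∀ x i, f x i = g x i) : f = g :=
  ContinuousLinearMap.ext fun x ↦ lp.ext (funext fun i ↦ h x i)

open ContinuousLinearMap in
lemma lp.mapCLM_adjoint {ι : Type*} {H : Type*} [NormedAddCommGroup H] [InnerProductSpace ℂ H]
    [CompleteSpace H] {S T : ι → H →L[ℂ] H} {K : ℝ} (hK : 0 ≤ K) (hS : ∀ i, ‖S i‖ ≤ K)
    (hT : ∀ i, ‖T i‖ ≤ K) (h : ∀ i, S i = star (T i)) :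
    (lp.mapCLM 2 S hK hS : lp (fun _ : ι ↦ H) 2 →L[ℂ] lp (fun _ : ι ↦ H) 2) =
      star (lp.mapCLM 2 T hK hT) := by
  rw [star_eq_adjoint, eq_adjoint_iff]
  intro x y
  rw [lp.inner_eq_tsum, lp.inner_eq_tsum]
  congr 1
  funext i
  change inner ℂ (S i (x i)) (y i) = inner ℂ (x i) (T i (y i))
  rw [h, star_eq_adjoint, adjoint_inner_left]

lemma isWeightedHom_univMap₀ : IsWeightedHom (univMap₀ (A₀ := A₀) (A₁ := A₁) H) where
  map_add a b := lp.clm_ext fun x l ↦ by simp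
  map_smul c a := lp.clm_ext fun x l ↦ by simp
  map_star a := by
    have h : ∀ l : OrderZeroPair A₀ A₁ H, l.map₀ (star a) = star (l.map₀ a) := fun l ↦
      l.map₀.apply_star a
    have hle : ∀ l : OrderZeroPair A₀ A₁ H, ‖l.map₀ (star a)‖ ≤ ‖a‖ := fun l ↦ by
      simpa using l.orderZero₀.norm_le (star a)
    exact lp.mapCLM_adjoint (norm_nonneg a) hle (fun l ↦ l.orderZero₀.norm_le a) h
  commute_one a := lp.clm_ext fun x l ↦ by
    simpa using! congr($(l.orderZero₀.isWeightedHom.commute_one a) (x l))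
  mul_self a ha := lp.clm_ext fun x l ↦ by
    simpa using! congr($(l.orderZero₀.isWeightedHom.mul_self a ha) (x l))
  one_mul a b := lp.clm_ext fun x l ↦ by
    simpa using! congr($(l.orderZero₀.isWeightedHom.one_mul a b) (x l))

lemma isWeightedHom_univMap₁ : IsWeightedHom (univMap₁ (A₀ := A₀) (A₁ := A₁) H) where
  map_add a b := lp.clm_ext fun x l ↦ by simp
  map_smul c a := lp.clm_ext fun x l ↦ by simp
  map_star a := by
    have h : ∀ l : OrderZeroPair A₀ A₁ H, l.map₁ (star a) = star (l.map₁ a) := fun l ↦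
      l.map₁.apply_star a
    have hle : ∀ l : OrderZeroPair A₀ A₁ H, ‖l.map₁ (star a)‖ ≤ ‖a‖ := fun l ↦ by
      simpa using l.orderZero₁.norm_le (star a)
    exact lp.mapCLM_adjoint (norm_nonneg a) hle (fun l ↦ l.orderZero₁.norm_le a) h
  commute_one a := lp.clm_ext fun x l ↦ by
    simpa using! congr($(l.orderZero₁.isWeightedHom.commute_one a) (x l))
  mul_self a ha := lp.clm_ext fun x l ↦ by
    simpa using! congr($(l.orderZero₁.isWeightedHom.mul_self a ha) (x l))
  one_mul a b := lp.clm_ext fun x l ↦ by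
    simpa using! congr($(l.orderZero₁.isWeightedHom.one_mul a b) (x l))

lemma commute_univMap (a₀ : A₀) (a₁ : A₁) :
    Commute (univMap₀ (A₁ := A₁) H a₀) (univMap₁ (A₀ := A₀) H a₁) :=
  lp.clm_ext fun x l ↦ by simpa using! congr($(l.commute a₀ a₁) (x l))

lemma univMap_one_add :
    univMap₀ (A₀ := A₀) (A₁ := A₁) H 1 + univMap₁ (A₀ := A₀) (A₁ := A₁) H 1 = 1 :=
  lp.clm_ext fun x l ↦ by simpa using! congr($(l.map_one_add) (x l))

end Universal

/-! ### States and representations -/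

section States

open scoped ComplexOrder

variable {D : Type*} [CStarAlgebra D]

/-- Compare `‖a + it‖² ≤ ‖a‖² + t²` with `(Im g a + t)²`: the cross term `2 t Im g a` would be
unbounded in `t` unless `Im g a = 0`. -/
lemma IsSelfAdjoint.im_apply_eq_zero {g : StrongDual ℂ D} (hg : ‖g‖ ≤ 1) (hg1 : g 1 = 1) {a : D}
    (ha : IsSelfAdjoint a) : (g a).im = 0 := by
  have key : ∀ t : ℝ, (g a).im ^ 2 + 2 * (g a).im * t ≤ ‖a‖ ^ 2 := by
    intro t
    have h1 : ‖a + ((t : ℂ) * Complex.I) • (1 : D)‖ ^ 2 ≤ ‖a‖ ^ 2 + t ^ 2 := by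
      rw [sq, ← CStarRing.norm_star_mul_self]
      have : star (a + ((t : ℂ) * Complex.I) • (1 : D)) * (a + ((t : ℂ) * Complex.I) • (1 : D)) =
          a * a + ((t : ℂ) ^ 2) • (1 : D) := by
        simp only [star_add, ha.star_eq, star_smul, star_one, mul_add, add_mul, smul_mul_assoc,
          mul_smul_comm, one_mul, mul_one, smul_smul, smul_add, star_mul', Complex.star_def,
          Complex.conj_ofReal, Complex.conj_I]
        rw [show (t : ℂ) * Complex.I * (t * -Complex.I) = t ^ 2 * -(Complex.I * Complex.I) by ring,
          Complex.I_mul_I]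
        module
      rw [this]
      have hone : ‖(1 : D)‖ ≤ 1 := by
        rcases subsingleton_or_nontrivial D with _ | _
        · simp [Subsingleton.elim (1 : D) 0]
        · simp
      calc _ ≤ ‖a * a‖ + ‖((t : ℂ) ^ 2) • (1 : D)‖ := norm_add_le _ _
        _ ≤ ‖a‖ * ‖a‖ + t ^ 2 * 1 := by
            gcongr
            · exact norm_mul_le _ _
            · rw [norm_smul]
              simpa using mul_le_mul_of_nonneg_left hone (sq_nonneg t)
        _ = _ := by ring
    have h2 : ‖g (a + ((t : ℂ) * Complex.I) • (1 : D))‖ ^ 2 ≤ ‖a‖ ^ 2 + t ^ 2 :=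
      le_trans (by gcongr; simpa using g.le_of_opNorm_le hg (a + ((t : ℂ) * Complex.I) • (1 : D))) h1
    rw [map_add, map_smul, hg1, Complex.sq_norm, Complex.normSq_apply] at h2
    simp at h2
    nlinarith [sq_nonneg (g a).re]
  by_contra h
  have := key ((‖a‖ ^ 2 + 1) / (2 * (g a).im))
  rw [mul_div_cancel₀ _ (by simpa using h)] at this
  nlinarith [sq_nonneg (g a).im]

/-- Since `‖a‖ - a` has norm at most `‖a‖`, the real number `g a` lies within `‖a‖` of `‖a‖`. -/
lemma StrongDual.apply_nonneg_of_norm_le_one [PartialOrder D] [StarOrderedRing D]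
    {g : StrongDual ℂ D} (hg : ‖g‖ ≤ 1) (hg1 : g 1 = 1) {a : D} (ha : 0 ≤ a) : 0 ≤ g a := by
  have him := (IsSelfAdjoint.of_nonneg ha).im_apply_eq_zero hg hg1
  have h1 : ‖algebraMap ℝ D ‖a‖ - a‖ ≤ ‖a‖ := by
    have h0 : 0 ≤ algebraMap ℝ D ‖a‖ - a :=
      sub_nonneg.2 (IsSelfAdjoint.of_nonneg ha).le_algebraMap_norm_self
    refine (CStarAlgebra.norm_le_iff_le_algebraMap _ (norm_nonneg a) h0).2 ?_
    exact sub_le_self _ ha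
  have h2 := (g.le_of_opNorm_le hg (algebraMap ℝ D ‖a‖ - a)).trans (by simpa using h1)
  have h3 : g (algebraMap ℝ D ‖a‖) = (‖a‖ : ℂ) := by
    rw [Algebra.algebraMap_eq_smul_one, ← Complex.coe_smul, map_smul, hg1]; simp
  rw [map_sub, h3] at h2
  have h4 := (Complex.abs_re_le_norm _).trans h2
  rw [abs_le] at h4
  rw [Complex.nonneg_iff]
  simp at h4
  exact ⟨by linarith [h4.2], him.symm⟩

/-- Being the real and imaginary parts of one normal element, `h` and `b` lie in a commutative
C⋆-algebra. A character there with value `‖b‖` at `b` extends by Hahn–Banach with the same norm,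
hence positively, and it remains multiplicative on `h`. -/
lemma exists_state [PartialOrder D] [StarOrderedRing D] [Nontrivial D] {h b : D}
    (hh : IsSelfAdjoint h) (hb : 0 ≤ b) (hc : Commute h b) :
    ∃ (ω : D →ₚ[ℂ] ℂ) (s : ℝ), ω 1 = 1 ∧ ω b = ‖b‖ ∧ ω h = s ∧ ω (h * h) = s * s := by
  have hbsa := IsSelfAdjoint.of_nonneg hb
  let z : D := h + Complex.I • b
  have hz : star z = h - Complex.I • b := by
    simp [z, hh.star_eq, hbsa.star_eq, sub_eq_add_neg]
  have : IsStarNormal z := ⟨by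
    rw [hz]
    exact (Commute.refl h).sub_left (hc.symm.smul_left _) |>.add_right
      ((hc.smul_right _).sub_left ((Commute.refl b).smul_left _ |>.smul_right _))⟩
  let E := StarAlgebra.elemental ℂ z
  have hzE : z ∈ E := StarAlgebra.elemental.self_mem ℂ z
  have hzE' : star z ∈ E := StarAlgebra.elemental.star_self_mem ℂ z
  have hhE : h ∈ E := by
    have : h = (2⁻¹ : ℂ) • (z + star z) := by rw [hz]; simp only [z]; module
    rw [this]
    exact E.smul_mem (add_mem hzE hzE') _
  have hbE : b ∈ E := by
    have : b = (-(2⁻¹ : ℂ) * Complex.I) • (z - star z) := by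
      rw [hz]
      simp only [z]
      rw [show h + Complex.I • b - (h - Complex.I • b) = (2 * Complex.I) • b by module, smul_smul,
        show -(2⁻¹ : ℂ) * Complex.I * (2 * Complex.I) = -(Complex.I * Complex.I) by ring,
        Complex.I_mul_I]
      simp
    rw [this]
    exact E.smul_mem (sub_mem hzE hzE') _
  have hspec : (‖b‖ : ℂ) ∈ spectrum ℂ (⟨b, hbE⟩ : E) := by
    have : IsClosed (E : Set D) := StarAlgebra.elemental.isClosed ℂ z
    rw [StarSubalgebra.spectrum_eq]
    exact spectrum.algebraMap_mem ℂ (CStarAlgebra.norm_mem_spectrum_of_nonneg hb)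
  obtain ⟨χ, hχ⟩ := WeakDual.CharacterSpace.mem_spectrum_iff_exists.1 hspec
  have hχn : ∀ x : E, ‖χ x‖ ≤ 1 * ‖x‖ := fun x ↦ by
    rw [one_mul]; exact NonUnitalStarAlgHom.norm_apply_le χ x
  obtain ⟨g, hg, hgn⟩ := exists_extension_norm_eq (𝕜 := ℂ) E.toSubalgebra.toSubmodule
    (LinearMap.mkContinuous (WeakDual.CharacterSpace.toAlgHom χ).toLinearMap 1 hχn)
  have hgE : ∀ x : E, g x = χ x := fun x ↦ hg x
  have hgn1 : ‖g‖ ≤ 1 := hgn.trans_le (LinearMap.mkContinuous_norm_le _ zero_le_one _)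
  have hg1 : g 1 = 1 := (hgE 1).trans (map_one χ)
  have hgh : g h = ((g h).re : ℂ) :=
    Complex.ext rfl (by simpa using hh.im_apply_eq_zero hgn1 hg1)
  refine ⟨PositiveLinearMap.mk₀ g.toLinearMap fun a ha ↦
    StrongDual.apply_nonneg_of_norm_le_one hgn1 hg1 ha, (g h).re, hg1, ?_, hgh, ?_⟩
  · exact (hgE ⟨b, hbE⟩).trans hχ
  · change g (h * h) = _
    rw [← hgh]
    have := map_mul χ (⟨h, hhE⟩ : E) ⟨h, hhE⟩
    rwa [← hgE, ← hgE] at this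

end States

/-! ### GNS representations turning a central element into a scalar. -/

section GNS

open scoped ComplexOrder InnerProductSpace

variable {D : Type*} [CStarAlgebra D] [PartialOrder D] [StarOrderedRing D] (ω : D →ₚ[ℂ] ℂ)

namespace PositiveLinearMap

/-- The image of `x` in the GNS space. -/
def gnsVector (x : D) : ω.GNS := (ω.toPreGNS x : ω.GNS)

lemma norm_gnsVector_sq (x : D) : (‖ω.gnsVector x‖ : ℂ) ^ 2 = ω (star x * x) := by
  rw [gnsVector, UniformSpace.Completion.norm_coe]
  exact ω.preGNS_norm_sq _

lemma gnsStarAlgHom_gnsVector (a x : D) :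
    ω.gnsStarAlgHom a (ω.gnsVector x) = ω.gnsVector (a * x) := by
  simp [gnsVector]

lemma gnsVector_sub (x y : D) : ω.gnsVector (x - y) = ω.gnsVector x - ω.gnsVector y := by
  simp [gnsVector, UniformSpace.Completion.coe_sub]

lemma gnsVector_smul (c : ℂ) (x : D) : ω.gnsVector (c • x) = c • ω.gnsVector x := by
  simp [gnsVector, UniformSpace.Completion.coe_smul]

lemma denseRange_gnsVector : DenseRange ω.gnsVector :=
  UniformSpace.Completion.denseRange_coe (α := ω.PreGNS)

lemma continuous_gnsVector : Continuous ω.gnsVector := by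
  have h : ω.gnsVector = fun a ↦ ω.gnsStarAlgHom a (ω.gnsVector 1) := by
    funext a; rw [gnsStarAlgHom_gnsVector, mul_one]
  rw [h]
  have hc : Continuous ω.gnsStarAlgHom :=
    AddMonoidHomClass.continuous_of_bound ω.gnsStarAlgHom 1 fun a ↦ by
      rw [one_mul]; exact NonUnitalStarAlgHom.norm_apply_le _ a
  exact (ContinuousLinearMap.apply ℂ ω.GNS (ω.gnsVector 1)).continuous.comp hc

/-- If a state is multiplicative on the central element `h`, then `h` acts as a scalar. -/
lemma gnsStarAlgHom_central {h : D} (hh : IsSelfAdjoint h) (hc : ∀ x, Commute h x) {s : ℝ}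
    (h1 : ω 1 = 1) (hs : ω h = s) (hs2 : ω (h * h) = s * s) :
    ω.gnsStarAlgHom h = (s : ℂ) • 1 := by
  -- Since `ω ((h - s)²) = 0`, the element `h - s` kills the cyclic vector; being central, it kills
  -- the dense orbit of that vector.
  have h0 : ω.gnsVector (h - (s : ℂ) • 1) = 0 := by
    have := ω.norm_gnsVector_sq (h - (s : ℂ) • 1)
    have e : star (h - (s : ℂ) • (1 : D)) * (h - (s : ℂ) • 1) =
        h * h - ((2 * s : ℂ)) • h + (s * s : ℂ) • 1 := by
      simp only [star_sub, hh.star_eq, star_smul, star_one, Complex.star_def, Complex.conj_ofReal,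
        sub_mul, mul_sub, smul_mul_assoc, mul_smul_comm, one_mul, mul_one, smul_smul, smul_sub]
      module
    rw [e, map_add, map_sub, map_smul, map_smul, h1, hs, hs2] at this
    have e2 : (s : ℂ) * s - (2 * s : ℂ) • (s : ℂ) + (s * s : ℂ) • (1 : ℂ) = 0 := by
      simp only [smul_eq_mul]; ring
    rw [e2] at this
    simpa using this
  ext x
  induction x using ω.denseRange_gnsVector.induction_on with
  | hp => exact isClosed_eq (ω.gnsStarAlgHom h).continuous ((s : ℂ) • 1 : ω.GNS →L[ℂ] ω.GNS).continuous
  | ih x =>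
    have e : h * x - (s : ℂ) • x = x * (h - (s : ℂ) • 1) := by
      rw [mul_sub, (hc x).eq, mul_smul_comm, mul_one]
    rw [gnsStarAlgHom_gnsVector, smul_apply, one_apply_eq_self, ← sub_eq_zero,
      ← gnsVector_smul, ← gnsVector_sub, e, ← gnsStarAlgHom_gnsVector, h0, map_zero]

end PositiveLinearMap

end GNS

/-- Every element of a C⋆-algebra is normed by a representation in which a given central
element is a scalar. -/
lemma exists_representation_central {D : Type u} [CStarAlgebra D] [Nontrivial D] {h : D}
    (hh : IsSelfAdjoint h) (hc : ∀ x, Commute h x) (x : D) :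
    ∃ (K : Type u) (_ : NormedAddCommGroup K) (_ : InnerProductSpace ℂ K) (_ : CompleteSpace K)
      (π : D →⋆ₐ[ℂ] (K →L[ℂ] K)) (s : ℝ), Nontrivial K ∧
      (TopologicalSpace.SeparableSpace D → TopologicalSpace.SeparableSpace K) ∧
      π h = (s : ℂ) • 1 ∧ ‖x‖ ≤ ‖π x‖ := by
  let _ : PartialOrder D := CStarAlgebra.spectralOrder D
  have : StarOrderedRing D := CStarAlgebra.spectralOrderedRing D
  -- The state attains the norm of `star x * x`, so `x` moves the cyclic unit vector to a vector of
  -- norm `‖x‖`.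
  obtain ⟨ω, s, h1, h2, h3, h4⟩ := exists_state hh (star_mul_self_nonneg x) (hc _)
  have hn1 : ‖ω.gnsVector 1‖ = 1 := by
    have := ω.norm_gnsVector_sq 1
    rw [star_one, mul_one, h1] at this
    norm_cast at this
    exact (pow_eq_one_iff_of_nonneg (norm_nonneg _) two_ne_zero).1 this
  have hx : ‖x‖ = ‖ω.gnsVector x‖ := by
    have := ω.norm_gnsVector_sq x
    rw [h2, CStarRing.norm_star_mul_self] at this
    norm_cast at this
    rw [← sq] at this
    exact ((sq_eq_sq₀ (norm_nonneg _) (norm_nonneg _)).1 this).symm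
  refine ⟨ω.GNS, inferInstance, inferInstance, inferInstance, ω.gnsStarAlgHom, s, ?_, fun _ ↦ ?_,
    ω.gnsStarAlgHom_central hh hc h1 h3 h4, ?_⟩
  · exact ⟨ω.gnsVector 1, 0, fun h ↦ by simp [h] at hn1⟩
  · exact ω.denseRange_gnsVector.separableSpace ω.continuous_gnsVector
  · have := (ω.gnsStarAlgHom x).le_opNorm (ω.gnsVector 1)
    rwa [ω.gnsStarAlgHom_gnsVector, mul_one, hn1, mul_one, ← hx] at this

/-! ### Amplification -/

section Amplification

open ContinuousLinearMap UniformSpace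

variable (K K' : Type*) [NormedAddCommGroup K] [InnerProductSpace ℂ K]
  [NormedAddCommGroup K'] [InnerProductSpace ℂ K']

/-- The Hilbert space tensor product. -/
abbrev HilbertTensor : Type _ := Completion (K ⊗[ℂ] K')

variable {K K'}

lemma HilbertTensor.clm_ext {f g : HilbertTensor K K' →L[ℂ] HilbertTensor K K'}
    (h : ∀ x y, f ((x ⊗ₜ[ℂ] y : K ⊗[ℂ] K') : HilbertTensor K K') =
      g ((x ⊗ₜ[ℂ] y : K ⊗[ℂ] K') : HilbertTensor K K')) : f = g := by
  ext z
  induction z using Completion.induction_on with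
  | hp => exact isClosed_eq f.continuous g.continuous
  | ih z =>
    induction z using TensorProduct.induction_on with
    | zero => rw [Completion.coe_zero, map_zero, map_zero]
    | tmul x y => exact h x y
    | add x y hx hy => rw [Completion.coe_add, map_add, map_add, hx, hy]

lemma HilbertTensor.eq_adjoint {f g : (K ⊗[ℂ] K') →L[ℂ] (K ⊗[ℂ] K')}
    (h : ∀ x y x' y', inner ℂ (f (x ⊗ₜ[ℂ] y)) (x' ⊗ₜ[ℂ] y') = inner ℂ (x ⊗ₜ[ℂ] y) (g (x' ⊗ₜ[ℂ] y'))) :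
    f.completion = star (g.completion) := by
  rw [star_eq_adjoint, eq_adjoint_iff]
  intro z w
  induction z, w using Completion.induction_on₂ with
  | hp => apply isClosed_eq <;> fun_prop
  | ih z w =>
    rw [completion_apply_coe, completion_apply_coe, Completion.inner_coe, Completion.inner_coe]
    induction z using TensorProduct.induction_on with
    | zero => simp
    | add x y hx hy => rw [map_add, inner_add_left, inner_add_left, hx, hy]
    | tmul x y =>
      induction w using TensorProduct.induction_on with
      | zero => simp
      | add x y hx hy => rw [map_add, inner_add_right, inner_add_right, hx, hy]
      | tmul x' y' => exact h x y x' y'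

variable (K K') in
/-- The representation `a ↦ a ⊗ 1`. -/
def ampLeft [CompleteSpace K] : (K →L[ℂ] K) →⋆ₐ[ℂ] (HilbertTensor K K' →L[ℂ] HilbertTensor K K') where
  toFun a := (a.rTensor K').completion
  map_one' := HilbertTensor.clm_ext fun x y ↦ by simp
  map_mul' a b := HilbertTensor.clm_ext fun x y ↦ by simp
  map_zero' := HilbertTensor.clm_ext fun x y ↦ by simp
  map_add' a b := HilbertTensor.clm_ext fun x y ↦ by
    simp [Completion.coe_add]
  commutes' c := HilbertTensor.clm_ext fun x y ↦ by
    simp [Algebra.algebraMap_eq_smul_one, ← Completion.coe_smul, TensorProduct.smul_tmul']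
  map_star' a := HilbertTensor.eq_adjoint fun x y x' y' ↦ by
    simp [star_eq_adjoint, adjoint_inner_left]

variable (K K') in
/-- The representation `b ↦ 1 ⊗ b`. -/
def ampRight [CompleteSpace K'] : (K' →L[ℂ] K') →⋆ₐ[ℂ] (HilbertTensor K K' →L[ℂ] HilbertTensor K K') where
  toFun a := (a.lTensor K).completion
  map_one' := HilbertTensor.clm_ext fun x y ↦ by simp
  map_mul' a b := HilbertTensor.clm_ext fun x y ↦ by simp
  map_zero' := HilbertTensor.clm_ext fun x y ↦ by simp
  map_add' a b := HilbertTensor.clm_ext fun x y ↦ by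
    simp [Completion.coe_add]
  commutes' c := HilbertTensor.clm_ext fun x y ↦ by
    simp [Algebra.algebraMap_eq_smul_one, ← Completion.coe_smul]
  map_star' a := HilbertTensor.eq_adjoint fun x y x' y' ↦ by
    simp [star_eq_adjoint, adjoint_inner_left]

lemma ampLeft_apply_tmul [CompleteSpace K] (a : K →L[ℂ] K) (x : K) (y : K') :
    ampLeft K K' a ((x ⊗ₜ[ℂ] y : K ⊗[ℂ] K') : HilbertTensor K K') =
      ((a x ⊗ₜ[ℂ] y : K ⊗[ℂ] K') : HilbertTensor K K') := by
  simp [ampLeft]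

lemma ampRight_apply_tmul [CompleteSpace K'] (b : K' →L[ℂ] K') (x : K) (y : K') :
    ampRight K K' b ((x ⊗ₜ[ℂ] y : K ⊗[ℂ] K') : HilbertTensor K K') =
      ((x ⊗ₜ[ℂ] b y : K ⊗[ℂ] K') : HilbertTensor K K') := by
  simp [ampRight]

lemma commute_amp [CompleteSpace K] [CompleteSpace K'] (a : K →L[ℂ] K) (b : K' →L[ℂ] K') :
    Commute (ampLeft K K' a) (ampRight K K' b) :=
  HilbertTensor.clm_ext fun x y ↦ by
    rw [mul_apply_eq_comp, mul_apply_eq_comp, ampRight_apply_tmul, ampLeft_apply_tmul,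
      ampLeft_apply_tmul, ampRight_apply_tmul]

lemma ampLeft_injective [CompleteSpace K] [Nontrivial K'] : Function.Injective (ampLeft K K') := by
  rw [injective_iff_map_eq_zero]
  intro a ha
  ext x
  obtain ⟨y, hy⟩ := exists_ne (0 : K')
  have := ampLeft_apply_tmul a x y
  rw [ha, zero_apply] at this
  have h2 := congrArg norm this
  rw [Completion.norm_coe, TensorProduct.norm_tmul, norm_zero] at h2
  simpa [hy] using h2.symm

lemma ampRight_injective [CompleteSpace K'] [Nontrivial K] : Function.Injective (ampRight K K') := by
  rw [injective_iff_map_eq_zero]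
  intro b hb
  ext y
  obtain ⟨x, hx⟩ := exists_ne (0 : K)
  have := ampRight_apply_tmul b x y
  rw [hb, zero_apply] at this
  have h2 := congrArg norm this
  rw [Completion.norm_coe, TensorProduct.norm_tmul, norm_zero] at h2
  simpa [hx] using h2.symm

end Amplification

/-! ### The universal property of the maximal tensor product -/

section TensorLift

variable {A B : Type*} [CStarAlgebra A] [CStarAlgebra B] {C : Type*} [CStarAlgebra C]

/-- The ⋆-homomorphism on the algebraic tensor product given by commuting ⋆-homomorphisms. -/
def algTensorLift (ρ : A →⋆ₐ[ℂ] C) (σ : B →⋆ₐ[ℂ] C) (h : ∀ a b, Commute (ρ a) (σ b)) :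
    A ⊗[ℂ] B →⋆ₐ[ℂ] C where
  __ := Algebra.TensorProduct.lift ρ.toAlgHom σ.toAlgHom h
  map_star' x := by
    induction x using TensorProduct.induction_on with
    | zero => simp
    | tmul a b => simpa [map_star] using ((h (star a) (star b)).eq)
    | add x y hx hy => simp only [star_add] at *; simp_all [map_add]

@[simp] lemma algTensorLift_tmul (ρ : A →⋆ₐ[ℂ] C) (σ : B →⋆ₐ[ℂ] C)
    (h : ∀ a b, Commute (ρ a) (σ b)) (a : A) (b : B) :
    algTensorLift ρ σ h (a ⊗ₜ b) = ρ a * σ b := by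
  simp [algTensorLift]

/-- The C⋆-seminorm of a ⋆-homomorphism. -/
def CStarSeminorm.ofHom {R : Type*} [Ring R] [StarRing R] [Algebra ℂ R] (f : R →⋆ₐ[ℂ] C) :
    CStarSeminorm R where
  __ := (normSeminorm ℂ C).comp f.toAlgHom.toLinearMap
  mul_le' x y := by
    change ‖f (x * y)‖ ≤ ‖f x‖ * ‖f y‖
    rw [map_mul]; exact norm_mul_le _ _
  star_mul_self' x := by
    change ‖f (star x * x)‖ = ‖f x‖ ^ 2
    rw [map_mul, map_star, CStarRing.norm_star_mul_self, sq]

lemma norm_le_maxTensorNorm (f : A ⊗[ℂ] B →⋆ₐ[ℂ] C) (x : A ⊗[ℂ] B) :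
    ‖f x‖ ≤ maxTensorNorm A B x :=
  le_ciSup (CStarSeminorm.bddAbove_range x) (CStarSeminorm.ofHom f)

/-- A ⋆-homomorphism on the algebraic tensor product, on the seminormed algebra that is completed
to the maximal tensor product. -/
def preMaxTensorHom (f : A ⊗[ℂ] B →⋆ₐ[ℂ] C) : (maxTensorNorm A B).Pre →⋆ₐ[ℂ] C :=
  f.comp (maxTensorNorm A B).toPre.symm

lemma continuous_preMaxTensorHom (f : A ⊗[ℂ] B →⋆ₐ[ℂ] C) : Continuous (preMaxTensorHom f) :=
  AddMonoidHomClass.continuous_of_bound (preMaxTensorHom f) 1 fun x ↦ by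
    rw [one_mul]; exact norm_le_maxTensorNorm f x

/-- The extension of a ⋆-homomorphism to the maximal tensor product. -/
def maxTensorExtend (f : A ⊗[ℂ] B →⋆ₐ[ℂ] C) : CStarTensor A B →⋆ₐ[ℂ] C where
  __ := UniformSpace.Completion.extensionHom (preMaxTensorHom f : (maxTensorNorm A B).Pre →+* C)
      (continuous_preMaxTensorHom f)
  commutes' c := (UniformSpace.Completion.extensionHom_coe
    (preMaxTensorHom f : (maxTensorNorm A B).Pre →+* C) (continuous_preMaxTensorHom f)
      (algebraMap ℂ _ c)).trans ((preMaxTensorHom f).toAlgHom.commutes c)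
  map_star' x := by
    change UniformSpace.Completion.extension (preMaxTensorHom f) (star x) =
      star (UniformSpace.Completion.extension (preMaxTensorHom f) x)
    have hu : UniformContinuous (preMaxTensorHom f) :=
      uniformContinuous_addMonoidHom_of_continuous (continuous_preMaxTensorHom f)
    have hc := (maxTensorNorm A B).continuous_star_completion
    induction x using UniformSpace.Completion.induction_on with
    | hp =>
      exact isClosed_eq (UniformSpace.Completion.continuous_extension.comp hc)
        (continuous_star.comp UniformSpace.Completion.continuous_extension)
    | ih x =>
      rw [CStarSeminorm.star_coe, UniformSpace.Completion.extension_coe hu,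
        UniformSpace.Completion.extension_coe hu, map_star]

lemma maxTensorExtend_toCompletion (f : A ⊗[ℂ] B →⋆ₐ[ℂ] C) (x : A ⊗[ℂ] B) :
    maxTensorExtend f ((maxTensorNorm A B).toCompletion x) = f x :=
  UniformSpace.Completion.extensionHom_coe
    (preMaxTensorHom f : (maxTensorNorm A B).Pre →+* C) (continuous_preMaxTensorHom f) x

variable (A B) in
lemma denseRange_toCompletion : DenseRange (maxTensorNorm A B).toCompletion :=
  UniformSpace.Completion.denseRange_coe (α := (maxTensorNorm A B).Pre)

/-- Commuting ⋆-homomorphisms induce a ⋆-homomorphism of the maximal tensor product. -/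
lemma exists_tensor_hom (ρ : A →⋆ₐ[ℂ] C) (σ : B →⋆ₐ[ℂ] C) (h : ∀ a b, Commute (ρ a) (σ b)) :
    ∃ R : CStarTensor A B →⋆ₐ[ℂ] C, (∀ a, R (tensorLeft A B a) = ρ a) ∧
      ∀ b, R (tensorRight A B b) = σ b := by
  refine ⟨maxTensorExtend (algTensorLift ρ σ h), fun a ↦ ?_, fun b ↦ ?_⟩
  · refine (maxTensorExtend_toCompletion _ _).trans ?_
    exact (algTensorLift_tmul ρ σ h a 1).trans (by simp)
  · refine (maxTensorExtend_toCompletion _ _).trans ?_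
    exact (algTensorLift_tmul ρ σ h 1 b).trans (by simp)

lemma commute_tensorLeft_tensorRight (a : A) (b : B) :
    Commute (tensorLeft A B a) (tensorRight A B b) := by
  refine Commute.map (x := algTensorLeft A B a) (y := algTensorRight A B b) ?_
    (maxTensorNorm A B).toCompletion
  change (a ⊗ₜ[ℂ] (1 : B)) * ((1 : A) ⊗ₜ[ℂ] b) = ((1 : A) ⊗ₜ[ℂ] b) * (a ⊗ₜ[ℂ] (1 : B))
  simp

lemma toCompletion_tmul (a : A) (b : B) :
    (maxTensorNorm A B).toCompletion (a ⊗ₜ b) = tensorLeft A B a * tensorRight A B b := by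
  change _ = (maxTensorNorm A B).toCompletion (a ⊗ₜ[ℂ] (1 : B)) *
    (maxTensorNorm A B).toCompletion ((1 : A) ⊗ₜ[ℂ] b)
  rw [← map_mul]
  simp

variable (A B) in
/-- The products `a ⊗ b` span a dense subspace. -/
lemma dense_span_tensor :
    Dense (Submodule.span ℂ (Set.range fun p : A × B ↦ tensorLeft A B p.1 * tensorRight A B p.2) :
      Set (CStarTensor A B)) := by
  refine (denseRange_toCompletion A B).mono ?_
  rintro _ ⟨x, rfl⟩
  induction x using TensorProduct.induction_on with
  | zero => rw [map_zero]; exact zero_mem _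
  | tmul a b => rw [toCompletion_tmul]; exact Submodule.subset_span ⟨(a, b), rfl⟩
  | add x y hx hy => rw [map_add]; exact add_mem hx hy

section Representations

variable {K K' : Type*} [NormedAddCommGroup K] [InnerProductSpace ℂ K] [CompleteSpace K]
  [NormedAddCommGroup K'] [InnerProductSpace ℂ K'] [CompleteSpace K']

/-- The commuting pair `π ⊗ 1`, `1 ⊗ π'` factors through the tensor product, and amplification is
faithful. With norming `π` this yields injectivity of `a ↦ a ⊗ 1`. -/
lemma apply_eq_zero_of_tensorLeft [Nontrivial K']
    (π : A →⋆ₐ[ℂ] (K →L[ℂ] K)) (π' : B →⋆ₐ[ℂ] (K' →L[ℂ] K')) {a : A} (ha : tensorLeft A B a = 0) :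
    π a = 0 := by
  obtain ⟨R, hR, -⟩ := exists_tensor_hom
    (C := HilbertTensor K K' →L[ℂ] HilbertTensor K K') ((ampLeft K K').comp π) ((ampRight K K').comp π')
    fun a b ↦ commute_amp (π a) (π' b)
  have h1 := hR a
  rw [ha] at h1
  exact ampLeft_injective (K := K) (K' := K') ((h1.symm.trans (map_zero R)).trans (map_zero (ampLeft K K')).symm)

lemma apply_eq_zero_of_tensorRight [Nontrivial K]
    (π : A →⋆ₐ[ℂ] (K →L[ℂ] K)) (π' : B →⋆ₐ[ℂ] (K' →L[ℂ] K')) {b : B} (hb : tensorRight A B b = 0) :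
    π' b = 0 := by
  obtain ⟨R, -, hR⟩ := exists_tensor_hom
    (C := HilbertTensor K K' →L[ℂ] HilbertTensor K K') ((ampLeft K K').comp π) ((ampRight K K').comp π')
    fun a b ↦ commute_amp (π a) (π' b)
  have h1 := hR b
  rw [hb] at h1
  exact ampRight_injective (K := K) (K' := K') ((h1.symm.trans (map_zero R)).trans (map_zero (ampRight K K')).symm)

end Representations

/-- Every element of a C⋆-algebra is normed by a representation. -/
lemma exists_representation {D : Type u} [CStarAlgebra D] [Nontrivial D] (x : D) :
    ∃ (K : Type u) (_ : NormedAddCommGroup K) (_ : InnerProductSpace ℂ K) (_ : CompleteSpace K)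
      (π : D →⋆ₐ[ℂ] (K →L[ℂ] K)), Nontrivial K ∧
      (TopologicalSpace.SeparableSpace D → TopologicalSpace.SeparableSpace K) ∧
      ‖x‖ ≤ ‖π x‖ := by
  obtain ⟨K, i1, i2, i3, π, s, h1, h2, -, h3⟩ :=
    exists_representation_central (IsSelfAdjoint.zero D) (fun _ ↦ Commute.zero_left _) x
  exact ⟨K, i1, i2, i3, π, h1, h2, h3⟩

variable (A B) in
lemma tensorLeft_injective [Nontrivial B] : Function.Injective (tensorLeft A B) := by
  rw [injective_iff_map_eq_zero]
  intro a ha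
  rcases subsingleton_or_nontrivial A with _ | _
  · exact Subsingleton.elim _ _
  obtain ⟨K, _, _, _, π, _, _, hπ⟩ := exists_representation a
  obtain ⟨K', _, _, _, π', _, _, _⟩ := exists_representation (0 : B)
  rw [apply_eq_zero_of_tensorLeft π π' ha, norm_zero] at hπ
  exact norm_le_zero_iff.1 hπ

variable (A B) in
lemma tensorRight_injective [Nontrivial A] : Function.Injective (tensorRight A B) := by
  rw [injective_iff_map_eq_zero]
  intro b hb
  rcases subsingleton_or_nontrivial B with _ | _
  · exact Subsingleton.elim _ _
  obtain ⟨K, _, _, _, π, _, _, _⟩ := exists_representation (0 : A)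
  obtain ⟨K', _, _, _, π', _, _, hπ⟩ := exists_representation b
  rw [apply_eq_zero_of_tensorRight π π' hb, norm_zero] at hπ
  exact norm_le_zero_iff.1 hπ

lemma nontrivial_cstarTensor [Nontrivial A] [Nontrivial B] : Nontrivial (CStarTensor A B) :=
  (tensorLeft_injective A B).nontrivial

lemma separableSpace_cstarTensor [TopologicalSpace.SeparableSpace A]
    [TopologicalSpace.SeparableSpace B] : TopologicalSpace.SeparableSpace (CStarTensor A B) := by
  have hL : Continuous (tensorLeft A B) :=
    AddMonoidHomClass.continuous_of_bound (tensorLeft A B) 1 fun a ↦ by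
      rw [one_mul]; exact NonUnitalStarAlgHom.norm_apply_le _ a
  have hR : Continuous (tensorRight A B) :=
    AddMonoidHomClass.continuous_of_bound (tensorRight A B) 1 fun a ↦ by
      rw [one_mul]; exact NonUnitalStarAlgHom.norm_apply_le _ a
  have h1 : TopologicalSpace.IsSeparable
      (Set.range fun p : A × B ↦ tensorLeft A B p.1 * tensorRight A B p.2) :=
    TopologicalSpace.isSeparable_range (by fun_prop)
  have h2 := (h1.span (R := ℂ)).closure
  rw [(dense_span_tensor A B).closure_eq] at h2
  exact TopologicalSpace.isSeparable_univ_iff.1 h2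

end TensorLift

/-! ### Separable Hilbert spaces -/

section Separable

lemma Orthonormal.countable_of_separable {ι E : Type*} [NormedAddCommGroup E]
    [InnerProductSpace ℂ E] [TopologicalSpace.SeparableSpace E] {v : ι → E}
    (hv : Orthonormal ℂ v) : Countable ι := by
  have h : Pairwise fun i j ↦ Disjoint (Metric.ball (v i) 2⁻¹) (Metric.ball (v j) 2⁻¹) := by
    intro i j hij
    refine Metric.ball_disjoint_ball ?_
    have h2 : ‖v i - v j‖ ^ 2 = 2 := by
      rw [@norm_sub_sq ℂ, hv.1 i, hv.1 j, hv.2 hij]; norm_num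
    rw [dist_eq_norm]
    nlinarith [norm_nonneg (v i - v j)]
  have := Set.PairwiseDisjoint.countable_of_isOpen (a := Set.univ)
    (s := fun i ↦ Metric.ball (v i) 2⁻¹) (fun i _ j _ hij ↦ h hij) (fun _ _ ↦ Metric.isOpen_ball)
    (fun i _ ↦ ⟨v i, Metric.mem_ball_self (by norm_num)⟩)
  exact Set.countable_univ_iff.1 this

lemma exists_hilbertBasis_nat (E : Type*) [NormedAddCommGroup E] [InnerProductSpace ℂ E]
    [CompleteSpace E] [TopologicalSpace.SeparableSpace E] (hE : ¬ FiniteDimensional ℂ E) :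
    Nonempty (HilbertBasis ℕ ℂ E) := by
  obtain ⟨w, b, -⟩ := exists_hilbertBasis ℂ E
  have : Countable w := b.orthonormal.countable_of_separable
  have : Infinite w := by
    by_contra hfin
    have : Finite w := not_infinite_iff_finite.1 hfin
    have := Fintype.ofFinite w
    exact hE (b.toOrthonormalBasis.toBasis.finiteDimensional_of_finite)
  obtain ⟨e⟩ : Nonempty (ℕ ≃ w) := by
    obtain ⟨_⟩ := nonempty_denumerable w
    exact ⟨(Denumerable.eqv w).symm⟩
  refine ⟨HilbertBasis.mk (v := b ∘ e) (b.orthonormal.comp e e.injective) ?_⟩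
  rw [e.surjective.range_comp]
  exact b.dense_span.ge

lemma nonempty_linearIsometryEquiv (E F : Type*) [NormedAddCommGroup E] [InnerProductSpace ℂ E]
    [CompleteSpace E] [TopologicalSpace.SeparableSpace E] (hE : ¬ FiniteDimensional ℂ E)
    [NormedAddCommGroup F] [InnerProductSpace ℂ F]
    [CompleteSpace F] [TopologicalSpace.SeparableSpace F] (hF : ¬ FiniteDimensional ℂ F) :
    Nonempty (E ≃ₗᵢ[ℂ] F) := by
  obtain ⟨b⟩ := exists_hilbertBasis_nat E hE
  obtain ⟨c⟩ := exists_hilbertBasis_nat F hF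
  exact ⟨b.repr.trans c.repr.symm⟩

open UniformSpace

variable {K H : Type*} [NormedAddCommGroup K] [InnerProductSpace ℂ K]
  [NormedAddCommGroup H] [InnerProductSpace ℂ H]

lemma HilbertTensor.separableSpace [TopologicalSpace.SeparableSpace K]
    [TopologicalSpace.SeparableSpace H] :
    TopologicalSpace.SeparableSpace (HilbertTensor K H) := by
  have h1 : TopologicalSpace.IsSeparable
      (Set.range fun p : K × H ↦ p.1 ⊗ₜ[ℂ] p.2) :=
    TopologicalSpace.isSeparable_range (by fun_prop)
  have h2 := h1.span (R := ℂ)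
  rw [show Set.range (fun p : K × H ↦ p.1 ⊗ₜ[ℂ] p.2) = {t | ∃ m n, m ⊗ₜ[ℂ] n = t} by
    ext; simp, TensorProduct.span_tmul_eq_top] at h2
  have : TopologicalSpace.SeparableSpace (K ⊗[ℂ] H) :=
    TopologicalSpace.isSeparable_univ_iff.1 (by simpa using h2)
  exact Completion.denseRange_coe.separableSpace (Completion.continuous_coe (K ⊗[ℂ] H))

lemma HilbertTensor.not_finiteDimensional [Nontrivial K] (hH : ¬ FiniteDimensional ℂ H) :
    ¬ FiniteDimensional ℂ (HilbertTensor K H) := by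
  intro h
  obtain ⟨x, hx⟩ := exists_ne (0 : K)
  let f : H →ₗ[ℂ] HilbertTensor K H :=
    (Completion.toComplL : (K ⊗[ℂ] H) →L[ℂ] HilbertTensor K H).toLinearMap ∘ₗ
      TensorProduct.mk ℂ K H x
  refine hH (FiniteDimensional.of_injective f ?_)
  rw [injective_iff_map_eq_zero]
  intro y hy
  have h2 := congrArg norm hy
  change ‖((x ⊗ₜ[ℂ] y : K ⊗[ℂ] H) : HilbertTensor K H)‖ = _ at h2
  rw [Completion.norm_coe, TensorProduct.norm_tmul, norm_zero] at h2
  simpa [hx] using h2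

/-- Every element of a separable C⋆-algebra is normed by a representation on a given separable
infinite-dimensional Hilbert space. -/
lemma exists_representation_on [CompleteSpace H] [TopologicalSpace.SeparableSpace H]
    (hH : ¬ FiniteDimensional ℂ H) {D : Type*} [CStarAlgebra D] [Nontrivial D]
    [hD : TopologicalSpace.SeparableSpace D] (x : D) :
    ∃ π : D →⋆ₐ[ℂ] (H →L[ℂ] H), ‖x‖ ≤ ‖π x‖ := by
  obtain ⟨K, _, _, _, π, _, hK, hπ⟩ := exists_representation x
  have := hK hD
  -- The GNS space may be finite-dimensional; tensoring it with `H` makes it infinite-dimensional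
  -- and keeps it separable, hence isometric to `H`.
  have := HilbertTensor.separableSpace (K := K) (H := H)
  obtain ⟨U⟩ := nonempty_linearIsometryEquiv (HilbertTensor K H) H
    (HilbertTensor.not_finiteDimensional hH) hH
  have : Nontrivial H := by
    by_contra h
    have := not_nontrivial_iff_subsingleton.1 h
    exact hH inferInstance
  let σ : (K →L[ℂ] K) →⋆ₐ[ℂ] (H →L[ℂ] H) :=
    (U.conjStarAlgEquiv : _ →⋆ₐ[ℂ] (H →L[ℂ] H)).comp (ampLeft K H)
  have hσ : Function.Injective σ := U.conjStarAlgEquiv.injective.comp ampLeft_injective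
  exact ⟨σ.comp π, hπ.trans (NonUnitalStarAlgHom.norm_map σ hσ (π x)).ge⟩

end Separable

/-! ### Generated C⋆-algebras -/

section Adjoin

open NonUnitalStarAlgebra

/-- Isometry passes to the closure by continuity, and the isometric image of a complete space is
closed, so it fills the whole target. -/
lemma nonempty_equiv_closure_adjoin {R P : Type*} [NonUnitalCStarAlgebra R]
    [NonUnitalCStarAlgebra P] (f : R →⋆ₙₐ[ℂ] P) (s : Set R)
    (h : ∀ z ∈ adjoin ℂ s, ‖f z‖ = ‖z‖) :
    Nonempty ((adjoin ℂ s).topologicalClosure ≃⋆ₐ[ℂ] (adjoin ℂ (f '' s)).topologicalClosure) := by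
  have hf : Continuous f := map_continuous f
  have h' : ∀ z ∈ (adjoin ℂ s).topologicalClosure, ‖f z‖ = ‖z‖ := fun z hz ↦
    closure_minimal (t := {z | ‖f z‖ = ‖z‖}) h
      (isClosed_eq hf.norm continuous_norm) hz
  have hmem : ∀ z ∈ (adjoin ℂ s).topologicalClosure,
      f z ∈ (adjoin ℂ (f '' s)).topologicalClosure := fun z hz ↦ by
    have := image_closure_subset_closure_image hf ⟨z, hz, rfl⟩
    rw [← NonUnitalStarAlgHom.map_adjoin]
    exact this
  let g : (adjoin ℂ s).topologicalClosure →⋆ₙₐ[ℂ] (adjoin ℂ (f '' s)).topologicalClosure :=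
    NonUnitalStarAlgHom.codRestrict (f.comp (NonUnitalStarSubalgebraClass.subtype _)) _
      fun x ↦ hmem x x.2
  have hg : Isometry fun x : (adjoin ℂ s).topologicalClosure ↦ f x :=
    Isometry.of_dist_eq fun x y ↦ by
      rw [dist_eq_norm, ← map_sub, h' _ (sub_mem x.2 y.2), Subtype.dist_eq, dist_eq_norm]
  have hcl : IsClosed (Set.range fun x : (adjoin ℂ s).topologicalClosure ↦ f x) := by
    have : CompleteSpace (adjoin ℂ s).topologicalClosure :=
      (adjoin ℂ s).isClosed_topologicalClosure.completeSpace_coe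
    exact hg.isClosedEmbedding.isClosed_range
  refine ⟨StarAlgEquiv.ofBijective g ⟨fun x y hxy ↦ hg.injective (congrArg Subtype.val hxy),
    fun y ↦ ?_⟩⟩
  have hy : (y : P) ∈ Set.range fun x : (adjoin ℂ s).topologicalClosure ↦ f x := by
    refine closure_minimal ?_ hcl y.2
    rw [← NonUnitalStarAlgHom.map_adjoin]
    rintro _ ⟨x, hx, rfl⟩
    exact ⟨⟨x, subset_closure hx⟩, rfl⟩
  obtain ⟨x, hx⟩ := hy
  exact ⟨x, Subtype.ext hx⟩

/-- Two families generate isomorphic C⋆-algebras if all their polynomials have equal norms. -/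
lemma nonempty_equiv_of_norm_eq {P Q : Type*} [NonUnitalCStarAlgebra P]
    [NonUnitalCStarAlgebra Q] (s : Set (P × Q)) (h : ∀ z ∈ adjoin ℂ s, ‖z.1‖ = ‖z.2‖) :
    Nonempty ((adjoin ℂ (Prod.fst '' s)).topologicalClosure ≃⋆ₐ[ℂ]
      (adjoin ℂ (Prod.snd '' s)).topologicalClosure) := by
  -- The product carries the max norm, so equal coordinate norms make both projections isometric on
  -- the algebra generated by `s`.
  obtain ⟨e₁⟩ := nonempty_equiv_closure_adjoin (NonUnitalStarAlgHom.fst ℂ P Q) s fun z hz ↦ by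
    change ‖z.1‖ = max ‖z.1‖ ‖z.2‖
    rw [h z hz, max_self]
  obtain ⟨e₂⟩ := nonempty_equiv_closure_adjoin (NonUnitalStarAlgHom.snd ℂ P Q) s fun z hz ↦ by
    change ‖z.2‖ = max ‖z.1‖ ‖z.2‖
    rw [h z hz, max_self]
  exact ⟨e₁.symm.trans e₂⟩

end Adjoin

/-! ### The generators of the interval algebra -/

section Interval

variable {A B : Type*} [CStarAlgebra A] [CStarAlgebra B]

variable (B) in
/-- The function `t ↦ (1 - t) (a ⊗ 1)`. -/
def intervalMap₀ (a : A) : C(unitInterval, CStarTensor A B) where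
  toFun t := ((1 - t : ℝ) : ℂ) • tensorLeft A B a
  continuous_toFun := by fun_prop

variable (A) in
/-- The function `t ↦ t (1 ⊗ b)`. -/
def intervalMap₁ (b : B) : C(unitInterval, CStarTensor A B) where
  toFun t := ((t : ℝ) : ℂ) • tensorRight A B b
  continuous_toFun := by fun_prop

@[simp] lemma intervalMap₀_apply (a : A) (t : unitInterval) :
    intervalMap₀ B a t = ((1 - t : ℝ) : ℂ) • tensorLeft A B a := rfl

@[simp] lemma intervalMap₁_apply (b : B) (t : unitInterval) :
    intervalMap₁ A b t = ((t : ℝ) : ℂ) • tensorRight A B b := rfl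

end Interval

/-! ### Evaluation pairs -/

section Scaled

variable {A : Type*} [CStarAlgebra A] [PartialOrder A] [StarOrderedRing A]
  {H : Type*} [NormedAddCommGroup H] [InnerProductSpace ℂ H] [CompleteSpace H]

/-- A nonnegative multiple of a ⋆-homomorphism, as a completely positive map. -/
def scaledHom (π : A →⋆ₐ[ℂ] (H →L[ℂ] H)) (c : ℝ) (hc : 0 ≤ c) : A →CP (H →L[ℂ] H) where
  __ := ((c : ℂ) • (π : A →ₗ[ℂ] (H →L[ℂ] H)))
  map_cstarMatrix_nonneg' k M hM := by
    have h1 : 0 ≤ M.map π := CompletelyPositiveMapClass.map_cstarMatrix_nonneg' π k M hM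
    have h2 : M.map (((c : ℂ) • (π : A →ₗ[ℂ] (H →L[ℂ] H)))) = c • M.map π := by
      ext i j
      simp [CStarMatrix.map_apply]
    change 0 ≤ M.map (((c : ℂ) • (π : A →ₗ[ℂ] (H →L[ℂ] H))))
    rw [h2]
    exact smul_nonneg hc h1

lemma scaledHom_apply (π : A →⋆ₐ[ℂ] (H →L[ℂ] H)) (c : ℝ) (hc : 0 ≤ c) (a : A) :
    scaledHom π c hc a = (c : ℂ) • π a := rfl

lemma isOrderZeroContraction_scaledHom (π : A →⋆ₐ[ℂ] (H →L[ℂ] H)) (c : ℝ) (hc : 0 ≤ c)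
    (hc1 : c ≤ 1) : IsOrderZeroContraction (scaledHom π c hc) where
  norm_le a := by
    rw [scaledHom_apply, norm_smul, Complex.norm_real, Real.norm_of_nonneg hc]
    exact (mul_le_of_le_one_left (norm_nonneg _) hc1).trans (NonUnitalStarAlgHom.norm_apply_le π a)
  orthogonal a b _ _ h := by
    rw [scaledHom_apply, scaledHom_apply, smul_mul_smul_comm, ← map_mul, h, map_zero, smul_zero]

end Scaled

section Evaluation

variable {A₀ A₁ : Type*} [CStarAlgebra A₀] [PartialOrder A₀] [StarOrderedRing A₀]
  [CStarAlgebra A₁] [PartialOrder A₁] [StarOrderedRing A₁]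
  {H : Type*} [NormedAddCommGroup H] [InnerProductSpace ℂ H] [CompleteSpace H]

/-- The pair obtained from a representation of the tensor product and a point of the interval. -/
def evaluationPair (ρ : CStarTensor A₀ A₁ →⋆ₐ[ℂ] (H →L[ℂ] H)) (t : unitInterval) :
    OrderZeroPair A₀ A₁ H where
  map₀ := scaledHom (ρ.comp (tensorLeft A₀ A₁)) (1 - t) (sub_nonneg.2 t.2.2)
  map₁ := scaledHom (ρ.comp (tensorRight A₀ A₁)) t t.2.1
  orderZero₀ := isOrderZeroContraction_scaledHom _ _ _ (by linarith [t.2.1])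
  orderZero₁ := isOrderZeroContraction_scaledHom _ _ _ t.2.2
  commute a b := by
    rw [scaledHom_apply, scaledHom_apply]
    exact (((commute_tensorLeft_tensorRight a b).map ρ).smul_left _).smul_right _
  map_one_add := by
    rw [scaledHom_apply, scaledHom_apply, map_one, map_one, ← add_smul]
    norm_num

/-- The relation between polynomials in the generators of the two algebras. -/
def generatorGraph (A₀ A₁ H : Type*) [CStarAlgebra A₀] [PartialOrder A₀] [StarOrderedRing A₀]
    [CStarAlgebra A₁] [PartialOrder A₁] [StarOrderedRing A₁]
    [NormedAddCommGroup H] [InnerProductSpace ℂ H] [CompleteSpace H] :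
    Set ((OrderZeroSpace A₀ A₁ H →L[ℂ] OrderZeroSpace A₀ A₁ H) ×
      C(unitInterval, CStarTensor A₀ A₁)) :=
  Set.range (fun a : A₀ ↦ (univMap₀ H a, intervalMap₀ A₁ a)) ∪
    Set.range (fun b : A₁ ↦ (univMap₁ H b, intervalMap₁ A₀ b))

/-- The claim for adjoints is carried through the induction because the star step needs it: it does
not follow from the first claim at that coordinate. -/
lemma apply_evaluationPair (ρ : CStarTensor A₀ A₁ →⋆ₐ[ℂ] (H →L[ℂ] H)) (t : unitInterval)
    {z} (hz : z ∈ NonUnitalStarAlgebra.adjoin ℂ (generatorGraph A₀ A₁ H)) :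
    (∀ x, z.1 x (evaluationPair ρ t) = ρ (z.2 t) (x (evaluationPair ρ t))) ∧
    ∀ x, star z.1 x (evaluationPair ρ t) = star (ρ (z.2 t)) (x (evaluationPair ρ t)) := by
  induction hz using NonUnitalStarAlgebra.adjoin_induction with
  | mem z hz =>
    rcases hz with ⟨a, rfl⟩ | ⟨a, rfl⟩
    · have h : ∀ a x, univMap₀ H a x (evaluationPair ρ t) =
          ρ (intervalMap₀ A₁ a t) (x (evaluationPair ρ t)) := fun a x ↦ by
        rw [univMap₀_apply, intervalMap₀_apply, map_smul]; rfl
      refine ⟨h a, fun x ↦ ?_⟩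
      change star (univMap₀ H a) x _ = star (ρ (intervalMap₀ A₁ a t)) _
      have hs : univMap₀ (A₁ := A₁) H (star a) = star (univMap₀ H a) :=
        isWeightedHom_univMap₀.map_star a
      rw [← hs, h, ← map_star]
      simp [map_star]
    · have h : ∀ a x, univMap₁ H a x (evaluationPair ρ t) =
          ρ (intervalMap₁ A₀ a t) (x (evaluationPair ρ t)) := fun a x ↦ by
        rw [univMap₁_apply, intervalMap₁_apply, map_smul]; rfl
      refine ⟨h a, fun x ↦ ?_⟩
      change star (univMap₁ H a) x _ = star (ρ (intervalMap₁ A₀ a t)) _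
      have hs : univMap₁ (A₀ := A₀) H (star a) = star (univMap₁ H a) :=
        isWeightedHom_univMap₁.map_star a
      rw [← hs, h, ← map_star]
      simp [map_star]
  | add y z _ _ hy hz =>
    refine ⟨fun x ↦ ?_, fun x ↦ ?_⟩
    · simp [hy.1, hz.1]
    · simp [hy.2, hz.2]
  | zero => simp
  | mul y z _ _ hy hz =>
    refine ⟨fun x ↦ ?_, fun x ↦ ?_⟩
    · simp [hy.1, hz.1]
    · simp [hy.2, hz.2]
  | smul c z _ hz =>
    refine ⟨fun x ↦ ?_, fun x ↦ ?_⟩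
    · simp [hz.1]
    · simp [hz.2]
  | star z _ hz =>
    refine ⟨fun x ↦ ?_, fun x ↦ ?_⟩
    · simp [hz.2, map_star]
    · simp [hz.1, map_star]

/-- For `ρ` norming `z.2 t`, the evaluation pair is an index of the direct sum, and vectors
supported at that index see `ρ (z.2 t)`. -/
lemma norm_snd_le_norm_fst [TopologicalSpace.SeparableSpace A₀] [Nontrivial A₀]
    [TopologicalSpace.SeparableSpace A₁] [Nontrivial A₁] [TopologicalSpace.SeparableSpace H]
    (hH : ¬ FiniteDimensional ℂ H) {z}
    (hz : z ∈ NonUnitalStarAlgebra.adjoin ℂ (generatorGraph A₀ A₁ H)) : ‖z.2‖ ≤ ‖z.1‖ := by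
  classical
  rw [ContinuousMap.norm_le _ (norm_nonneg _)]
  intro t
  have := nontrivial_cstarTensor (A := A₀) (B := A₁)
  have := separableSpace_cstarTensor (A := A₀) (B := A₁)
  obtain ⟨ρ, hρ⟩ := exists_representation_on hH (z.2 t)
  refine hρ.trans (ContinuousLinearMap.opNorm_le_bound _ (norm_nonneg _) fun x ↦ ?_)
  have h := (apply_evaluationPair ρ t hz).1 (lp.single 2 (evaluationPair ρ t) x)
  rw [lp.single_apply_self] at h
  rw [← h]
  refine (lp.norm_apply_le_norm two_ne_zero _ _).trans ((z.1.le_opNorm _).trans_eq ?_)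
  rw [lp.norm_single (by norm_num)]

end Evaluation

/-! ### Upper bound: the interval algebra dominates weighted homomorphisms. -/

section Upper

variable {A B : Type*} [CStarAlgebra A] [CStarAlgebra B]

/-- The graph relating weighted homomorphisms to the generators of the interval algebra. -/
def weightedGraph {D : Type*} (Φ : A → D) (Ψ : B → D) :
    Set (D × C(unitInterval, CStarTensor A B)) :=
  Set.range (fun a ↦ (Φ a, intervalMap₀ B a)) ∪ Set.range (fun b ↦ (Ψ b, intervalMap₁ A b))

variable {D E : Type*} [CStarAlgebra D] [CStarAlgebra E] {Φ : A → D} {Ψ : B → D}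

/-- The map `j` leaves room for composing with an amplification, needed at `t = 0` and `t = 1`. -/
lemma apply_weightedGraph (j : D →⋆ₐ[ℂ] E) (R : CStarTensor A B →⋆ₐ[ℂ] E) (t : unitInterval)
    (hΦ : ∀ a, j (Φ a) = ((1 - t : ℝ) : ℂ) • R (tensorLeft A B a))
    (hΨ : ∀ b, j (Ψ b) = ((t : ℝ) : ℂ) • R (tensorRight A B b)) {z}
    (hz : z ∈ NonUnitalStarAlgebra.adjoin ℂ (weightedGraph Φ Ψ)) : j z.1 = R (z.2 t) := by
  induction hz using NonUnitalStarAlgebra.adjoin_induction with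
  | mem z hz =>
    rcases hz with ⟨a, rfl⟩ | ⟨a, rfl⟩
    · rw [hΦ, intervalMap₀_apply, map_smul]
    · rw [hΨ, intervalMap₁_apply, map_smul]
  | add y z _ _ hy hz => simp [hy, hz]
  | zero => simp
  | mul y z _ _ hy hz => simp [hy, hz]
  | smul c z _ hz => simp [hz]
  | star z _ hz => simp [hz, map_star]

/-- If `Ψ 1` acts as the scalar `t` then, up to amplification, the weighted homomorphisms come from
a representation of the tensor product, evaluated at `t`. -/
lemma norm_le_norm_snd_of_scalar [Nontrivial A] [Nontrivial B] {K : Type*}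
    [NormedAddCommGroup K] [InnerProductSpace ℂ K] [CompleteSpace K] [Nontrivial K]
    (hΦ : IsWeightedHom Φ) (hΨ : IsWeightedHom Ψ) (hc : ∀ a b, Commute (Φ a) (Ψ b))
    (h1 : Φ 1 + Ψ 1 = 1) (π : D →⋆ₐ[ℂ] (K →L[ℂ] K)) (t : unitInterval)
    (ht : π (Ψ 1) = ((t : ℝ) : ℂ) • 1) {z}
    (hz : z ∈ NonUnitalStarAlgebra.adjoin ℂ (weightedGraph Φ Ψ)) : ‖π z.1‖ ≤ ‖z.2‖ := by
  have ht' : π (Φ 1) = ((1 - t : ℝ) : ℂ) • 1 := by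
    rw [eq_sub_of_add_eq h1, map_sub, ht, map_one]
    push_cast
    rw [sub_smul, one_smul]
  have hΦ' := hΦ.comp π
  have hΨ' := hΨ.comp π
  -- At `t = 0` the map `Ψ` dies under `π` and yields no representation of `B`. Any representation
  -- of `B` on a second tensor factor serves instead, since it enters with weight 0.
  rcases eq_or_ne (t : ℝ) 0 with h0 | h0
  · obtain ⟨ρ, hρ⟩ := hΦ'.exists_eq_smul (s := 1 - t) (by rw [h0]; norm_num) ht'
    obtain ⟨K', _, _, _, π', _, -, -⟩ := exists_representation (1 : B)
    obtain ⟨R, hR, -⟩ := exists_tensor_hom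
      (C := HilbertTensor K K' →L[ℂ] HilbertTensor K K') ((ampLeft K K').comp ρ)
      ((ampRight K K').comp π') fun a b ↦ commute_amp (ρ a) (π' b)
    have h := apply_weightedGraph ((ampLeft K K').comp π) R t (Φ := Φ) (Ψ := Ψ)
      (fun a ↦ by
        rw [hR]
        exact (congrArg (ampLeft K K') (hρ a)).trans (map_smul _ _ _))
      (fun b ↦ by
        rw [h0, Complex.ofReal_zero, zero_smul]
        exact (congrArg (ampLeft K K') (hΨ'.eq_zero (by simp [ht, h0]) b)).trans (map_zero _)) hz
    rw [← NonUnitalStarAlgHom.norm_map (ampLeft K K') ampLeft_injective (π z.1)]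
    exact ((congrArg norm h).le.trans (NonUnitalStarAlgHom.norm_apply_le R (z.2 t))).trans
      (z.2.norm_coe_le_norm t)
  rcases eq_or_ne (t : ℝ) 1 with h1 | h1
  · obtain ⟨ρ, hρ⟩ := hΨ'.exists_eq_smul h0 ht
    obtain ⟨K', _, _, _, π', _, -, -⟩ := exists_representation (1 : A)
    obtain ⟨R, -, hR⟩ := exists_tensor_hom
      (C := HilbertTensor K' K →L[ℂ] HilbertTensor K' K) ((ampLeft K' K).comp π')
      ((ampRight K' K).comp ρ) fun a b ↦ commute_amp (π' a) (ρ b)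
    have h := apply_weightedGraph ((ampRight K' K).comp π) R t (Φ := Φ) (Ψ := Ψ)
      (fun a ↦ by
        rw [h1, sub_self, Complex.ofReal_zero, zero_smul]
        exact (congrArg (ampRight K' K) (hΦ'.eq_zero (by simp [ht', h1]) a)).trans (map_zero _))
      (fun b ↦ by
        rw [hR]
        exact (congrArg (ampRight K' K) (hρ b)).trans (map_smul _ _ _)) hz
    rw [← NonUnitalStarAlgHom.norm_map (ampRight K' K) ampRight_injective (π z.1)]
    exact ((congrArg norm h).le.trans (NonUnitalStarAlgHom.norm_apply_le R (z.2 t))).trans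
      (z.2.norm_coe_le_norm t)
  · have h1' : (1 - t : ℝ) ≠ 0 := sub_ne_zero.2 (Ne.symm h1)
    obtain ⟨ρ, hρ⟩ := hΦ'.exists_eq_smul h1' ht'
    obtain ⟨ρ', hρ'⟩ := hΨ'.exists_eq_smul h0 ht
    obtain ⟨R, hR, hR'⟩ := exists_tensor_hom ρ ρ' fun a b ↦ by
      have h := (hc a b).map π
      rw [hρ, hρ'] at h
      have e0 : ((t : ℝ) : ℂ) ≠ 0 := Complex.ofReal_ne_zero.2 h0
      have e1 : ((1 - t : ℝ) : ℂ) ≠ 0 := Complex.ofReal_ne_zero.2 h1'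
      exact (Commute.smul_left_iff₀ e1).1 ((Commute.smul_right_iff₀ e0).1 h)
    have h := apply_weightedGraph π R t (Φ := Φ) (Ψ := Ψ) (fun a ↦ by rw [hR]; exact hρ a)
      (fun b ↦ by rw [hR']; exact hρ' b) hz
    exact ((congrArg norm h).le.trans (NonUnitalStarAlgHom.norm_apply_le R (z.2 t))).trans
      (z.2.norm_coe_le_norm t)

/-- The scalar `s` representing `Ψ 1` lies in `[0, 1]` because both `|s|` and `|1 - s|` are at most
1. -/
lemma norm_le_norm_snd_of_central [Nontrivial A] [Nontrivial B]
    (hΦ : IsWeightedHom Φ) (hΨ : IsWeightedHom Ψ) (hc : ∀ a b, Commute (Φ a) (Ψ b))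
    (h1 : Φ 1 + Ψ 1 = 1) (hcen : ∀ x, Commute (Ψ 1) x) (hΦ1 : ‖Φ 1‖ ≤ 1) (hΨ1 : ‖Ψ 1‖ ≤ 1) {z}
    (hz : z ∈ NonUnitalStarAlgebra.adjoin ℂ (weightedGraph Φ Ψ)) : ‖z.1‖ ≤ ‖z.2‖ := by
  rcases subsingleton_or_nontrivial D with hD | hD
  · rw [Subsingleton.elim z.1 0, norm_zero]; exact norm_nonneg _
  have hsa : IsSelfAdjoint (Ψ 1) := by
    rw [IsSelfAdjoint, ← hΨ.map_star, star_one]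
  obtain ⟨K, _, _, _, π, s, _, -, hs, hle⟩ := exists_representation_central hsa hcen z.1
  have hs1 : |s| ≤ 1 := by
    have := (NonUnitalStarAlgHom.norm_apply_le π (Ψ 1)).trans hΨ1
    rwa [hs, norm_smul, norm_one, mul_one, Complex.norm_real] at this
  have hs0 : |1 - s| ≤ 1 := by
    have := (NonUnitalStarAlgHom.norm_apply_le π (Φ 1)).trans hΦ1
    rw [eq_sub_of_add_eq h1, map_sub, hs, map_one] at this
    rwa [show (1 : K →L[ℂ] K) - (s : ℂ) • 1 = ((1 - s : ℝ) : ℂ) • 1 by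
      push_cast; rw [sub_smul, one_smul], norm_smul, norm_one, mul_one, Complex.norm_real] at this
  exact hle.trans (norm_le_norm_snd_of_scalar hΦ hΨ hc h1 π
    ⟨s, by linarith [abs_le.1 hs0], (abs_le.1 hs1).2⟩ hs hz)

/-- Every generator lies in the centralizer of `Ψ 1`, where `Ψ 1` is central; passing to this closed
subalgebra does not change norms. -/
lemma norm_le_norm_snd [Nontrivial A] [Nontrivial B]
    (hΦ : IsWeightedHom Φ) (hΨ : IsWeightedHom Ψ) (hc : ∀ a b, Commute (Φ a) (Ψ b))
    (h1 : Φ 1 + Ψ 1 = 1) (hΦ1 : ‖Φ 1‖ ≤ 1) (hΨ1 : ‖Ψ 1‖ ≤ 1) {z}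
    (hz : z ∈ NonUnitalStarAlgebra.adjoin ℂ (weightedGraph Φ Ψ)) : ‖z.1‖ ≤ ‖z.2‖ := by
  have hsa : star (Ψ 1) = Ψ 1 := by rw [← hΨ.map_star, star_one]
  let S := StarSubalgebra.centralizer ℂ {Ψ 1}
  have hmem : ∀ x, x ∈ S ↔ Commute (Ψ 1) x := fun x ↦ by
    simp [S, StarSubalgebra.mem_centralizer_iff, hsa, Commute, SemiconjBy]
  have : IsClosed (S : Set D) := by
    rw [show (S : Set D) = {x | Ψ 1 * x = x * Ψ 1} from Set.ext hmem]
    exact isClosed_eq (by fun_prop) (by fun_prop)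
  have hΦS : ∀ a, Φ a ∈ S := fun a ↦ (hmem _).2 (hc a 1).symm
  have hΨS : ∀ b, Ψ b ∈ S := fun b ↦ (hmem _).2 (hΨ.commute_one b).symm
  let σ : (S × C(unitInterval, CStarTensor A B)) →⋆ₙₐ[ℂ] (D × C(unitInterval, CStarTensor A B)) :=
    ((S.subtype : S →⋆ₙₐ[ℂ] D).comp (NonUnitalStarAlgHom.fst ℂ _ _)).prod
      (NonUnitalStarAlgHom.snd ℂ _ _)
  have hσ : weightedGraph Φ Ψ =
      σ '' weightedGraph (fun a ↦ (⟨Φ a, hΦS a⟩ : S)) fun b ↦ ⟨Ψ b, hΨS b⟩ := by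
    rw [weightedGraph, weightedGraph, Set.image_union, ← Set.range_comp, ← Set.range_comp]
    rfl
  rw [hσ, ← NonUnitalStarAlgHom.map_adjoin] at hz
  obtain ⟨z, hz, rfl⟩ := hz
  exact norm_le_norm_snd_of_central (D := S) (Φ := fun a ↦ ⟨Φ a, hΦS a⟩)
    (Ψ := fun b ↦ ⟨Ψ b, hΨS b⟩)
    (IsWeightedHom.of_comp_injective (σ := S.subtype) Subtype.val_injective hΦ)
    (IsWeightedHom.of_comp_injective (σ := S.subtype) Subtype.val_injective hΨ)
    (fun a b ↦ Subtype.ext (hc a b).eq) (Subtype.ext h1)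
    (fun x ↦ Subtype.ext (((hmem _).1 x.2).eq)) hΦ1 hΨ1 hz

end Upper

/-! ### Bernstein approximation -/

section Bernstein

open unitInterval

variable {E : Type*} [NormedAddCommGroup E] [NormedSpace ℂ E]

/-- The function `t ↦ t ^ i (1 - t) ^ j y`. -/
def bernsteinMonomial (i j : ℕ) : E →L[ℂ] C(I, E) where
  toFun y :=
    { toFun := fun t ↦ (((t : ℝ) : ℂ) ^ i * ((1 - t : ℝ) : ℂ) ^ j) • y
      continuous_toFun := by fun_prop }
  map_add' x y := by ext t; simp
  map_smul' c y := by ext t; simp [smul_comm c]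
  cont := by
    refine ContinuousMap.continuous_of_continuous_uncurry _ ?_
    change Continuous fun p : E × I ↦ (((p.2 : ℝ) : ℂ) ^ i * ((1 - p.2 : ℝ) : ℂ) ^ j) • p.1
    fun_prop

@[simp] lemma bernsteinMonomial_apply (i j : ℕ) (y : E) (t : I) :
    bernsteinMonomial i j y t = (((t : ℝ) : ℂ) ^ i * ((1 - t : ℝ) : ℂ) ^ j) • y := rfl

/-- In a Bernstein polynomial only the extreme terms lack a factor `t` or `1 - t`, and their
coefficients are `f 0` and `f 1`. All other terms carry both factors, so their coefficients need no
boundary condition. -/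
lemma Submodule.mem_of_bernsteinMonomial_mem {J : Submodule ℂ C(I, E)}
    (hJ : IsClosed (J : Set C(I, E))) {f : C(I, E)}
    (h0 : ∀ j, bernsteinMonomial 0 (j + 1) (f 0) ∈ J)
    (h1 : ∀ i, bernsteinMonomial (i + 1) 0 (f 1) ∈ J)
    (hmid : ∀ i j y, bernsteinMonomial (i + 1) (j + 1) y ∈ J) : f ∈ J := by
  refine hJ.mem_of_tendsto (bernsteinApproximation_uniform f) ?_
  filter_upwards [Filter.eventually_ge_atTop 1] with n hn
  have hsum : bernsteinApproximation n f = ∑ k : Fin (n + 1),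
      ((n.choose k : ℕ) : ℂ) • bernsteinMonomial k (n - k) (f (bernstein.z k)) := by
    ext t
    rw [bernsteinApproximation.apply, ContinuousMap.sum_apply]
    refine Finset.sum_congr rfl fun k _ ↦ ?_
    rw [ContinuousMap.smul_apply, bernsteinMonomial_apply, bernstein_apply, smul_smul,
      ← Complex.coe_smul]
    push_cast
    ring_nf
  rw [hsum]
  refine sum_mem fun k _ ↦ J.smul_mem _ ?_
  obtain ⟨n, rfl⟩ : ∃ m, n = m + 1 := ⟨n - 1, by lia⟩
  rcases eq_or_ne k 0 with rfl | hk0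
  · simpa using h0 n
  rcases eq_or_ne k (Fin.last _) with rfl | hk1
  · simpa using h1 n
  · obtain ⟨i, hi⟩ : ∃ i, (k : ℕ) = i + 1 :=
      ⟨k - 1, by have := Fin.val_ne_zero_iff.2 hk0; lia⟩
    obtain ⟨j, hj⟩ : ∃ j, n + 1 - (k : ℕ) = j + 1 := ⟨n - k, by
      have := Fin.val_lt_last hk1; lia⟩
    rw [hj, hi]
    exact hmid _ _ _

end Bernstein

/-! ### Generation of the interval algebra. -/

section Interval

variable {A B : Type*} [CStarAlgebra A] [CStarAlgebra B]

lemma StarAlgHom.isClosed_range_of_injective {A B : Type*} [CStarAlgebra A] [CStarAlgebra B]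
    (f : A →⋆ₐ[ℂ] B) (hf : Function.Injective f) : IsClosed (f.range : Set B) := by
  change IsClosed (Set.range f)
  exact (NonUnitalStarAlgHom.isometry f hf).isClosedEmbedding.isClosed_range

variable (A B) in
/-- The functions generating the interval algebra. -/
def intervalGenerators : Set C(unitInterval, CStarTensor A B) :=
  Set.range (intervalMap₀ B) ∪ Set.range (intervalMap₁ A)

open NonUnitalStarAlgebra

lemma mul_pow_mem {R S : Type*} [Monoid R] [SetLike S R] [MulMemClass S R] {s : S} {x y : R}
    (hx : x ∈ s) (hy : y ∈ s) (n : ℕ) : x * y ^ n ∈ s := by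
  induction n with
  | zero => simpa
  | succ n ih => rw [pow_succ, ← mul_assoc]; exact mul_mem ih hy

lemma smul_mul_smul_one_pow {R : Type*} [Ring R] [Algebra ℂ R] (x : ℂ) (a : R) (n : ℕ) :
    (x • a) * (x • 1) ^ n = x ^ (n + 1) • a := by
  rw [smul_pow, one_pow, smul_mul_smul_comm, mul_one, pow_succ']

/-- One weight of each kind is carried by `a` and `b`, the others by powers of the generators at
`1`; hence both exponents are positive. -/
lemma bernsteinMonomial_tensor (i j : ℕ) (a : A) (b : B) :
    bernsteinMonomial (i + 1) (j + 1) (tensorLeft A B a * tensorRight A B b) =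
      (intervalMap₀ B a * intervalMap₀ B 1 ^ j) * (intervalMap₁ A b * intervalMap₁ A 1 ^ i) := by
  ext t
  rw [ContinuousMap.mul_apply, ContinuousMap.mul_apply, ContinuousMap.mul_apply,
    ContinuousMap.pow_apply, ContinuousMap.pow_apply, intervalMap₀_apply, intervalMap₀_apply,
    intervalMap₁_apply, intervalMap₁_apply, map_one (tensorLeft A B), map_one (tensorRight A B),
    smul_mul_smul_one_pow, smul_mul_smul_one_pow, bernsteinMonomial_apply, smul_mul_smul_comm,
    mul_comm (_ ^ _)]

variable (A B) in
lemma closure_adjoin_intervalGenerators [Nontrivial A] [Nontrivial B] :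
    ((adjoin ℂ (intervalGenerators A B)).topologicalClosure :
      Set C(unitInterval, CStarTensor A B)) = intervalAlgebra A B := by
  refine subset_antisymm ?_ ?_
  · refine closure_minimal ?_ ?_
    · intro f hf
      rw [SetLike.mem_coe] at hf ⊢
      induction hf using adjoin_induction with
      | mem f hf =>
        rcases hf with ⟨a, rfl⟩ | ⟨b, rfl⟩
        · refine ⟨⟨a, ?_⟩, ⟨0, ?_⟩⟩ <;> simp
        · refine ⟨⟨0, ?_⟩, ⟨b, ?_⟩⟩ <;> simp
      | add _ _ _ _ hx hy => exact add_mem hx hy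
      | zero => exact zero_mem _
      | mul _ _ _ _ hx hy => exact mul_mem hx hy
      | smul c _ _ hx => exact SMulMemClass.smul_mem c hx
      | star _ _ hx => exact star_mem hx
    -- The boundary conditions are closed because injective ⋆-homomorphisms are isometric.
    · exact ((StarAlgHom.isClosed_range_of_injective _ (tensorLeft_injective A B)).preimage
        (continuous_eval_const 0)).inter
        ((StarAlgHom.isClosed_range_of_injective _ (tensorRight_injective A B)).preimage
        (continuous_eval_const 1))
  · rintro f ⟨⟨a, ha⟩, ⟨b, hb⟩⟩
    set J := (adjoin ℂ (intervalGenerators A B)).topologicalClosure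
    have hcl : IsClosed (J : Set C(unitInterval, CStarTensor A B)) :=
      (adjoin ℂ (intervalGenerators A B)).isClosed_topologicalClosure
    have hι₀ : ∀ a, intervalMap₀ B a ∈ J := fun a ↦
      subset_closure (subset_adjoin ℂ _ (Or.inl ⟨a, rfl⟩))
    have hι₁ : ∀ b, intervalMap₁ A b ∈ J := fun b ↦
      subset_closure (subset_adjoin ℂ _ (Or.inr ⟨b, rfl⟩))
    refine Submodule.mem_of_bernsteinMonomial_mem (J := J.toNonUnitalSubalgebra.toSubmodule) hcl
      (fun j ↦ ?_) (fun i ↦ ?_) fun i j y ↦ ?_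
    · have h : bernsteinMonomial 0 (j + 1) (f 0) = intervalMap₀ B a * intervalMap₀ B 1 ^ j := by
        ext t
        rw [ContinuousMap.mul_apply, ContinuousMap.pow_apply, intervalMap₀_apply,
          intervalMap₀_apply, map_one (tensorLeft A B), smul_mul_smul_one_pow,
          bernsteinMonomial_apply, pow_zero,
          one_mul]
        exact congrArg _ ha.symm
      exact h ▸ mul_pow_mem (hι₀ a) (hι₀ 1) j
    · have h : bernsteinMonomial (i + 1) 0 (f 1) = intervalMap₁ A b * intervalMap₁ A 1 ^ i := by
        ext t
        rw [ContinuousMap.mul_apply, ContinuousMap.pow_apply, intervalMap₁_apply,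
          intervalMap₁_apply, map_one (tensorRight A B), smul_mul_smul_one_pow,
          bernsteinMonomial_apply, pow_zero,
          mul_one]
        exact congrArg _ hb.symm
      exact h ▸ mul_pow_mem (hι₁ b) (hι₁ 1) i
    · have hy : y ∈ closure (Submodule.span ℂ
          (Set.range fun p : A × B ↦ tensorLeft A B p.1 * tensorRight A B p.2) :
            Set (CStarTensor A B)) := by
        rw [(dense_span_tensor A B).closure_eq]; trivial
      refine closure_minimal (t := bernsteinMonomial (i + 1) (j + 1) ⁻¹' J) ?_
        (hcl.preimage (bernsteinMonomial (i + 1) (j + 1)).continuous) hy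
      refine Submodule.span_le (p := J.toNonUnitalSubalgebra.toSubmodule.comap
        (bernsteinMonomial (i + 1) (j + 1)).toLinearMap).2 ?_
      rintro _ ⟨⟨a, b⟩, rfl⟩
      change bernsteinMonomial (i + 1) (j + 1) (tensorLeft A B a * tensorRight A B b) ∈ J
      rw [bernsteinMonomial_tensor]
      exact mul_mem (mul_pow_mem (hι₀ a) (hι₀ 1) j) (mul_pow_mem (hι₁ b) (hι₁ 1) i)

end Interval

/-! ### Equality of norms and the isomorphism. -/

section Universal

open NonUnitalStarAlgebra

variable {A₀ A₁ : Type*} [CStarAlgebra A₀] [PartialOrder A₀] [StarOrderedRing A₀]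
  [CStarAlgebra A₁] [PartialOrder A₁] [StarOrderedRing A₁]
  {H : Type*} [NormedAddCommGroup H] [InnerProductSpace ℂ H] [CompleteSpace H]

lemma norm_univMap₀_one_le : ‖univMap₀ (A₀ := A₀) (A₁ := A₁) H 1‖ ≤ 1 := by
  refine (lp.norm_mapCLM_le _ _ _ _).trans ?_
  rcases subsingleton_or_nontrivial A₀ with h | h
  · rw [Subsingleton.elim (1 : A₀) 0, norm_zero]; exact zero_le_one
  · rw [norm_one]

lemma norm_univMap₁_one_le : ‖univMap₁ (A₀ := A₀) (A₁ := A₁) H 1‖ ≤ 1 := by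
  refine (lp.norm_mapCLM_le _ _ _ _).trans ?_
  rcases subsingleton_or_nontrivial A₁ with h | h
  · rw [Subsingleton.elim (1 : A₁) 0, norm_zero]; exact zero_le_one
  · rw [norm_one]

lemma fst_image_generatorGraph : Prod.fst '' generatorGraph A₀ A₁ H =
    Set.range (univMap₀ (A₀ := A₀) (A₁ := A₁) H) ∪
      Set.range (univMap₁ (A₀ := A₀) (A₁ := A₁) H) := by
  rw [generatorGraph, Set.image_union, ← Set.range_comp, ← Set.range_comp]
  rfl

lemma snd_image_generatorGraph :
    Prod.snd '' generatorGraph A₀ A₁ H = intervalGenerators A₀ A₁ := by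
  rw [generatorGraph, Set.image_union, ← Set.range_comp, ← Set.range_comp]
  rfl

lemma norm_fst_eq_norm_snd [TopologicalSpace.SeparableSpace A₀] [Nontrivial A₀]
    [TopologicalSpace.SeparableSpace A₁] [Nontrivial A₁] [TopologicalSpace.SeparableSpace H]
    (hH : ¬ FiniteDimensional ℂ H) {z} (hz : z ∈ adjoin ℂ (generatorGraph A₀ A₁ H)) :
    ‖z.1‖ = ‖z.2‖ :=
  le_antisymm (norm_le_norm_snd (Φ := univMap₀ (A₁ := A₁) H) (Ψ := univMap₁ (A₀ := A₀) H)
    isWeightedHom_univMap₀ isWeightedHom_univMap₁ commute_univMap univMap_one_add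
    norm_univMap₀_one_le norm_univMap₁_one_le hz) (norm_snd_le_norm_fst hH hz)

lemma nonempty_equiv_starSubalgebra_of_norm_eq {P Q : Type*} [CStarAlgebra P] [CStarAlgebra Q]
    (s : Set (P × Q)) (h : ∀ z ∈ adjoin ℂ s, ‖z.1‖ = ‖z.2‖) {s₁ : Set P} {s₂ : Set Q}
    (h₁ : Prod.fst '' s = s₁) (h₂ : Prod.snd '' s = s₂) {S : StarSubalgebra ℂ Q}
    (hS : ((adjoin ℂ s₂).topologicalClosure : Set Q) = S) :
    Nonempty ((adjoin ℂ s₁).topologicalClosure ≃⋆ₐ[ℂ] S) := by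
  subst h₁ h₂
  obtain ⟨e⟩ := nonempty_equiv_of_norm_eq s h
  exact ⟨e.trans
    { Equiv.setCongr hS with
      map_add' := fun _ _ ↦ rfl
      map_mul' := fun _ _ ↦ rfl
      map_star' := fun _ ↦ rfl
      map_smul' := fun _ _ ↦ rfl }⟩

lemma nonempty_universalAlgebra_equiv [TopologicalSpace.SeparableSpace A₀] [Nontrivial A₀]
    [TopologicalSpace.SeparableSpace A₁] [Nontrivial A₁] [TopologicalSpace.SeparableSpace H]
    (hH : ¬ FiniteDimensional ℂ H) :
    Nonempty (universalAlgebra A₀ A₁ H ≃⋆ₐ[ℂ] intervalAlgebra A₀ A₁) :=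
  nonempty_equiv_starSubalgebra_of_norm_eq (generatorGraph A₀ A₁ H)
    (fun _ ↦ norm_fst_eq_norm_snd hH) fst_image_generatorGraph snd_image_generatorGraph
    (closure_adjoin_intervalGenerators A₀ A₁)

end Universal

/-! ### The flip of two commuting matrix algebras -/

section Flip

open Matrix

variable {n : Type*} [Fintype n] [DecidableEq n] {T : Type*} [Ring T] [StarRing T] [Algebra ℂ T]
  (L R : Matrix n n ℂ →⋆ₐ[ℂ] T)

/-- The flip `∑ L(eᵢⱼ) R(eⱼᵢ)`. -/
def matrixFlip : T := ∑ i, ∑ j, L (single i j 1) * R (single j i 1)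

variable {L R}

/-- In `M_n ⊗ M_n` the flip exchanges `m ⊗ 1` and `1 ⊗ m`; by linearity matrix units suffice. -/
lemma matrixFlip_mul (h : ∀ x y, Commute (L x) (R y)) (m : Matrix n n ℂ) :
    matrixFlip L R * L m = R m * matrixFlip L R := by
  have : (LinearMap.mulLeft ℂ (matrixFlip L R)).comp (L : Matrix n n ℂ →ₗ[ℂ] T) =
      (LinearMap.mulRight ℂ (matrixFlip L R)).comp (R : Matrix n n ℂ →ₗ[ℂ] T) := by
    refine Matrix.ext_linearMap ℂ fun p q ↦ LinearMap.ext_ring ?_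
    change matrixFlip L R * L (single p q 1) = R (single p q 1) * matrixFlip L R
    have h1 : ∀ i j, L (single i j 1) * R (single j i 1) * L (single p q 1) =
        if j = p then L (single i q 1) * R (single p i 1) else 0 := fun i j ↦ by
      rw [mul_assoc, ← (h _ _).eq, ← mul_assoc, ← map_mul]
      split_ifs with hj
      · subst hj; simp
      · rw [single_mul_single_of_ne _ _ _ _ hj]; simp
    have h2 : ∀ i j, R (single p q 1) * (L (single i j 1) * R (single j i 1)) =
        if q = j then L (single i q 1) * R (single p i 1) else 0 := fun i j ↦ by
      rw [← mul_assoc, ← (h _ _).eq, mul_assoc, ← map_mul]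
      split_ifs with hj
      · subst hj; simp
      · rw [single_mul_single_of_ne _ _ _ _ hj]; simp
    simp only [matrixFlip, Finset.sum_mul, Finset.mul_sum, h1, h2]
    simp
  exact LinearMap.congr_fun this m

lemma star_matrixFlip (h : ∀ x y, Commute (L x) (R y)) :
    star (matrixFlip L R) = matrixFlip L R := by
  simp only [matrixFlip, star_sum, star_mul, ← map_star, star_eq_conjTranspose,
    conjTranspose_single, star_one]
  rw [Finset.sum_comm]
  exact Finset.sum_congr rfl fun i _ ↦ Finset.sum_congr rfl fun j _ ↦ (h _ _).eq.symm

/-- Multiplying the flip into its own `(i, j)` term leaves `L(eⱼⱼ) R(eᵢᵢ)`, and these sum to `1`. -/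
lemma matrixFlip_mul_self (h : ∀ x y, Commute (L x) (R y)) :
    matrixFlip L R * matrixFlip L R = 1 := by
  have h1 : ∀ i j, matrixFlip L R * (L (single i j 1) * R (single j i 1)) =
      L (single j j 1) * R (single i i 1) := fun i j ↦ by
    rw [← mul_assoc, matrixFlip_mul h, matrixFlip, Finset.mul_sum, Finset.sum_mul]
    simp only [Finset.mul_sum, Finset.sum_mul]
    rw [Finset.sum_eq_single j, Finset.sum_eq_single j]
    · rw [← mul_assoc, ← (h _ _).eq, mul_assoc, mul_assoc, ← map_mul, ← map_mul]
      simp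
    · intro k _ hk
      rw [← mul_assoc (R _) (L _), ← (h _ _).eq, mul_assoc (L _), ← map_mul,
        single_mul_single_of_ne _ _ _ _ hk.symm]
      simp
    · simp
    · intro k _ hk
      refine Finset.sum_eq_zero fun l _ ↦ ?_
      rw [mul_assoc, mul_assoc, ← map_mul R, single_mul_single_of_ne _ _ _ _ hk]
      simp
    · simp
  have h2 : ∑ i : n, single i i (1 : ℂ) = 1 := by
    rw [← diagonal_one, ← sum_single_eq_diagonal]
  nth_rewrite 2 [matrixFlip]
  simp only [Finset.mul_sum, h1]
  simp only [← Finset.sum_mul, ← map_sum, h2, map_one, one_mul]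

end Flip

/-! ### A unitary path from `1` to the flip. -/

section Rotation

open Complex

variable {T : Type*} [CStarAlgebra T] (F : T)

/-- The path `t ↦ (1 + F) / 2 + e ^ (iπt) (1 - F) / 2` from `1` to `F`. -/
def rotationPath : C(unitInterval, T) where
  toFun t := (2⁻¹ : ℂ) • (1 + F) + (2⁻¹ * exp ((Real.pi * t : ℝ) * I)) • (1 - F)
  continuous_toFun := by fun_prop

variable {F}

lemma rotationPath_zero : rotationPath F 0 = 1 := by
  change (2⁻¹ : ℂ) • (1 + F) + (2⁻¹ * exp ((Real.pi * (0 : ℝ) : ℝ) * I)) • (1 - F) = 1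
  simp only [mul_zero, ofReal_zero, zero_mul, exp_zero, mul_one]
  module

lemma rotationPath_one : rotationPath F 1 = F := by
  change (2⁻¹ : ℂ) • (1 + F) + (2⁻¹ * exp ((Real.pi * (1 : ℝ) : ℝ) * I)) • (1 - F) = F
  rw [mul_one, exp_pi_mul_I]
  module

/-- The elements `(1 ± F) / 2` are orthogonal projections with sum `1`, and the path puts the
unimodular weights `1` and `e ^ (iπt)` on them. -/
lemma rotationPath_mem_unitary (hF : star F = F) (hFF : F * F = 1) :
    rotationPath F ∈ unitary C(unitInterval, T) := by
  have key : ∀ v w : ℂ, v * w = 1 →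
      ((2⁻¹ : ℂ) • (1 + F) + (2⁻¹ * v) • (1 - F)) * ((2⁻¹ : ℂ) • (1 + F) + (2⁻¹ * w) • (1 - F)) =
        1 := fun v w h ↦ by
    have e1 : (1 + F) * (1 + F) = (2 : ℂ) • (1 + F) := by
      rw [two_smul, mul_add, add_mul, add_mul, hFF]; noncomm_ring
    have e2 : (1 - F) * (1 - F) = (2 : ℂ) • (1 - F) := by
      rw [two_smul, mul_sub, sub_mul, sub_mul, hFF]; noncomm_ring
    have e3 : (1 + F) * (1 - F) = 0 := by
      rw [mul_sub, add_mul, add_mul, hFF]; noncomm_ring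
    have e4 : (1 - F) * (1 + F) = 0 := by
      rw [mul_add, sub_mul, sub_mul, hFF]; noncomm_ring
    rw [mul_add, add_mul, add_mul, smul_mul_smul_comm, smul_mul_smul_comm, smul_mul_smul_comm,
      smul_mul_smul_comm, e1, e2, e3, e4, mul_mul_mul_comm, h]
    module
  have hexp : ∀ s : ℝ, exp (s * I) * star (exp (s * I)) = 1 := fun s ↦ by
    rw [star_def, ← exp_conj, ← exp_add]
    simp
  have hstar : ∀ t, star (rotationPath F) t = (2⁻¹ : ℂ) • (1 + F) +
      (2⁻¹ * star (exp ((Real.pi * t : ℝ) * I))) • (1 - F) := fun t ↦ by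
    rw [ContinuousMap.star_apply, rotationPath, ContinuousMap.coe_mk]
    simp [hF]
  rw [Unitary.mem_iff]
  constructor <;> ext t <;> rw [ContinuousMap.mul_apply, hstar]
  · exact key _ _ ((mul_comm _ _).trans (hexp _))
  · exact key _ _ (hexp _)

lemma exists_hom_rotating {n : Type*} [Fintype n] [DecidableEq n]
    (L R : Matrix n n ℂ →⋆ₐ[ℂ] T) (h : ∀ x y, Commute (L x) (R y)) :
    ∃ g : Matrix n n ℂ →⋆ₐ[ℂ] C(unitInterval, T), ∀ m, g m 0 = L m ∧ g m 1 = R m := by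
  have hF := star_matrixFlip h
  have hFF := matrixFlip_mul_self h
  let U : unitary C(unitInterval, T) := ⟨_, rotationPath_mem_unitary hF hFF⟩
  let c : T →⋆ₐ[ℂ] C(unitInterval, T) :=
    { toFun := ContinuousMap.const _
      map_one' := rfl
      map_mul' := fun _ _ ↦ rfl
      map_zero' := rfl
      map_add' := fun _ _ ↦ rfl
      commutes' := fun _ ↦ rfl
      map_star' := fun _ ↦ rfl }
  refine ⟨((Unitary.conjStarAlgAut ℂ C(unitInterval, T) U : _ →⋆ₐ[ℂ] C(unitInterval, T)).comp
    c).comp L, fun m ↦ ⟨?_, ?_⟩⟩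
  · change rotationPath (matrixFlip L R) 0 * L m * star (rotationPath (matrixFlip L R) 0) = L m
    rw [rotationPath_zero, one_mul, star_one, mul_one]
  · change rotationPath (matrixFlip L R) 1 * L m * star (rotationPath (matrixFlip L R) 1) = R m
    rw [rotationPath_one, hF, matrixFlip_mul h, mul_assoc, hFF, mul_one]

end Rotation

lemma containsMatrixUnitally_intervalAlgebra {A B : Type*} [CStarAlgebra A] [CStarAlgebra B]
    [Nontrivial B] {k : ℕ} (hA : ContainsMatrixUnitally k A) (hB : ContainsMatrixUnitally k B) :
    ContainsMatrixUnitally k (intervalAlgebra A B) := by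
  obtain ⟨f, hf⟩ := hA
  obtain ⟨f', -⟩ := hB
  obtain ⟨g, hg⟩ := exists_hom_rotating ((tensorLeft A B).comp f) ((tensorRight A B).comp f')
    fun x y ↦ commute_tensorLeft_tensorRight (f x) (f' y)
  refine ⟨g.codRestrict (intervalAlgebra A B)
    fun m ↦ ⟨⟨f m, (hg m).1.symm⟩, ⟨f' m, (hg m).2.symm⟩⟩, fun x y hxy ↦ hf ?_⟩
  -- Injectivity is already visible at the endpoint `0`, where the path takes the value `f x ⊗ 1`.
  have h : g x = g y := congrArg Subtype.val hxy
  exact tensorLeft_injective A B ((hg x).1.symm.trans ((congrArg (fun u ↦ u 0) h).trans (hg y).1))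

end

theorem lemma2p1 {A₀ A₁ H : Type*}
    [CStarAlgebra A₀] [PartialOrder A₀] [StarOrderedRing A₀] [Nontrivial A₀]
    [TopologicalSpace.SeparableSpace A₀] (hA₀ : IsNuclear A₀)
    [CStarAlgebra A₁] [PartialOrder A₁] [StarOrderedRing A₁] [Nontrivial A₁]
    [TopologicalSpace.SeparableSpace A₁] (hA₁ : IsNuclear A₁)
    [NormedAddCommGroup H] [InnerProductSpace ℂ H] [CompleteSpace H]
    [TopologicalSpace.SeparableSpace H] (hH : ¬ FiniteDimensional ℂ H) :
    Nonempty (universalAlgebra A₀ A₁ H ≃⋆ₐ[ℂ] intervalAlgebra A₀ A₁) ∧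
    ∀ k : ℕ, ContainsMatrixUnitally k A₀ → ContainsMatrixUnitally k A₁ →
      ContainsMatrixUnitally k (intervalAlgebra A₀ A₁) :=
  ⟨nonempty_universalAlgebra_equiv hH, fun _ ↦ containsMatrixUnitally_intervalAlgebra⟩
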